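/- Let $N\in\mathbb N$, let $I\subset\mathbb R$ be a bounded interval, and let $G\colon\mathbb R^N\to[0,\infty)$ satisfy (G1) $G(0)=0$; (G2) $G$ is convex; (G3) $G$ is even; (G4) $G$ is supercoercive: $\lim_{|x|\to\infty} G(x)/|x|=\infty$; (G5) ($\Delta_2$) there are $K_1\ge 2$ and $M_1>0$ such that $G(2x)\le K_1G(x)$ whenever $|x|\ge M_1$; (G6) ($\nabla_2$) there are $K_2\ge 1$ and $M_2>0$ such that $G(x)\le \frac1{2K_2}G(K_2x)$ whenever $|x|\ge M_2$, where $|\cdot|$ is the Euclidean norm. Let $L^G(I,\mathbb R^N)$ be the space of measurable functions $u\colon I\to\mathbb R^N$ with $\int_I G(u)\,dt<\infty$, functions equal almost everywhere being identified, equipped with the Luxemburg norm $$\|u\|_{L^G}=\inf\Big\{\alpha>0\colon \int_I G\Big(\frac{u}{\alpha}\Big)\,dt\le 1\Big\}.$$ Then $L^G(I,\mathbb R^N)$ is a reflexive Banach space: it is a complete normed real vector space, and the canonical embedding into its bidual is surjective. -/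

import Mathlib

open MeasureTheory Filter Topology
open scoped ENNReal

/-- Conditions (G1)-(G6) on a function `G : ℝ^N → [0, ∞)`: `G 0 = 0`, `G` is convex, even and
supercoercive, and it satisfies the `Δ₂` and the `∇₂` condition (near infinity). -/
structure IsGFunction {N : ℕ} (G : EuclideanSpace ℝ (Fin N) → ℝ) : Prop where
  nonneg : ∀ x, 0 ≤ G x
  map_zero : G 0 = 0
  convex : ConvexOn ℝ Set.univ G
  even : ∀ x, G (-x) = G x
  supercoercive : Tendsto (fun x => G x / ‖x‖) (Bornology.cobounded _) atTop
  delta2 : ∃ K : ℝ, 2 ≤ K ∧ ∃ M : ℝ, 0 < M ∧ ∀ x, M ≤ ‖x‖ → G ((2 : ℝ) • x) ≤ K * G x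
  nabla2 : ∃ K : ℝ, 1 ≤ K ∧ ∃ M : ℝ, 0 < M ∧ ∀ x, M ≤ ‖x‖ → G x ≤ 1 / (2 * K) * G (K • x)

/-- The modular `∫_I G(u) dt`, as an element of `[0, ∞]`. -/
noncomputable def orliczModular {N : ℕ} (G : EuclideanSpace ℝ (Fin N) → ℝ) (I : Set ℝ)
    (u : ℝ → EuclideanSpace ℝ (Fin N)) : ℝ≥0∞ :=
  ∫⁻ t in I, ENNReal.ofReal (G (u t))

/-- The Luxemburg norm `inf {α > 0 : ∫_I G(u / α) dt ≤ 1}`. -/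
noncomputable def luxemburgNorm {N : ℕ} (G : EuclideanSpace ℝ (Fin N) → ℝ) (I : Set ℝ)
    (u : ℝ → EuclideanSpace ℝ (Fin N)) : ℝ :=
  sInf {α : ℝ | 0 < α ∧ orliczModular G I (fun t => α⁻¹ • u t) ≤ 1}

namespace IsGFunction

variable {N : ℕ} {G : EuclideanSpace ℝ (Fin N) → ℝ}

theorem continuous (hG : IsGFunction G) : Continuous G :=
  hG.convex.locallyLipschitz.continuous

theorem smul_le (hG : IsGFunction G) {a : ℝ} (h0 : 0 ≤ a) (h1 : a ≤ 1)
    (x : EuclideanSpace ℝ (Fin N)) : G (a • x) ≤ a * G x := by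
  have h := hG.convex.2 (Set.mem_univ x) (Set.mem_univ 0) h0 (sub_nonneg.2 h1) (by ring)
  simpa [hG.map_zero] using h

theorem le_smul (hG : IsGFunction G) {a : ℝ} (h1 : 1 ≤ a)
    (x : EuclideanSpace ℝ (Fin N)) : a * G x ≤ G (a • x) := by
  have ha : 0 < a := by linarith
  have h := hG.smul_le (inv_nonneg.2 ha.le) (inv_le_one_of_one_le₀ h1) (a • x)
  rw [smul_smul, inv_mul_cancel₀ ha.ne', one_smul] at h
  calc a * G x ≤ a * (a⁻¹ * G (a • x)) := by gcongr
    _ = G (a • x) := by field_simp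

theorem abs_smul (hG : IsGFunction G) (a : ℝ) (x : EuclideanSpace ℝ (Fin N)) :
    G (|a| • x) = G (a • x) := by
  rcases abs_choice a with h | h <;> rw [h]
  rw [neg_smul, hG.even]

theorem mono_smul (hG : IsGFunction G) {a b : ℝ} (h : |a| ≤ |b|)
    (x : EuclideanSpace ℝ (Fin N)) : G (a • x) ≤ G (b • x) := by
  rcases eq_or_lt_of_le (abs_nonneg b) with hb | hb
  · have ha : a = 0 := abs_eq_zero.1 (le_antisymm (h.trans hb.symm.le) (abs_nonneg a))
    rw [ha, zero_smul, hG.map_zero]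
    exact hG.nonneg _
  · rw [← hG.abs_smul a, ← hG.abs_smul b]
    have h2 := hG.smul_le (a := |a| / |b|) (by positivity) ((div_le_one hb).2 h) (|b| • x)
    rw [smul_smul, div_mul_cancel₀ _ hb.ne'] at h2
    exact h2.trans (mul_le_of_le_one_left (hG.nonneg _) ((div_le_one hb).2 h))

theorem exists_two_smul_le (hG : IsGFunction G) :
    ∃ C K : ℝ, 0 ≤ C ∧ 0 ≤ K ∧ ∀ x, G ((2 : ℝ) • x) ≤ C + K * G x := by
  obtain ⟨K, hK, M, -, h⟩ := hG.delta2
  have hc : Continuous fun x => G ((2 : ℝ) • x) := hG.continuous.comp (continuous_const_smul _)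
  obtain ⟨C, hC⟩ := (isCompact_closedBall (0 : EuclideanSpace ℝ (Fin N)) M).bddAbove_image
    hc.continuousOn
  refine ⟨max C 0, K, le_max_right _ _, by linarith, fun x => ?_⟩
  have hx0 : 0 ≤ K * G x := mul_nonneg (by linarith) (hG.nonneg x)
  rcases le_total M ‖x‖ with hx | hx
  · exact (h x hx).trans (le_add_of_nonneg_left (le_max_right _ _))
  · have := hC (Set.mem_image_of_mem (fun x => G ((2 : ℝ) • x)) (mem_closedBall_zero_iff.2 hx))
    exact this.trans ((le_max_left _ _).trans (le_add_of_nonneg_right hx0))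

theorem exists_pow_smul_le (hG : IsGFunction G) (n : ℕ) :
    ∃ C K : ℝ, 0 ≤ C ∧ 0 ≤ K ∧ ∀ x, G ((2 : ℝ) ^ n • x) ≤ C + K * G x := by
  induction n with
  | zero => exact ⟨0, 1, le_rfl, zero_le_one, fun x => by simp⟩
  | succ n ih =>
    obtain ⟨C, K, hC, hK, h⟩ := ih
    obtain ⟨C', K', hC', hK', h'⟩ := hG.exists_two_smul_le
    refine ⟨C' + K' * C, K' * K, by positivity, by positivity, fun x => ?_⟩
    rw [pow_succ', mul_smul]
    refine (h' _).trans ?_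
    have := mul_le_mul_of_nonneg_left (h x) hK'
    linarith

theorem exists_smul_le (hG : IsGFunction G) (c : ℝ) :
    ∃ C K : ℝ, 0 ≤ C ∧ 0 ≤ K ∧ ∀ x, G (c • x) ≤ C + K * G x := by
  obtain ⟨n, hn⟩ := pow_unbounded_of_one_lt |c| (one_lt_two : (1 : ℝ) < 2)
  obtain ⟨C, K, hC, hK, h⟩ := hG.exists_pow_smul_le n
  refine ⟨C, K, hC, hK, fun x => (hG.mono_smul ?_ x).trans (h x)⟩
  rw [abs_of_pos (by positivity : (0 : ℝ) < 2 ^ n)]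
  exact hn.le

theorem modular_smul_lt_top (hG : IsGFunction G) {I : Set ℝ} (hI : Bornology.IsBounded I) (c : ℝ)
    {u : ℝ → EuclideanSpace ℝ (Fin N)} (hu : orliczModular G I u < ∞) :
    orliczModular G I (fun t => c • u t) < ∞ := by
  obtain ⟨C, K, hC, hK, h⟩ := hG.exists_smul_le c
  calc orliczModular G I (fun t => c • u t)
      ≤ ∫⁻ t in I, (ENNReal.ofReal C + ENNReal.ofReal K * ENNReal.ofReal (G (u t))) := by
        refine lintegral_mono fun t => ?_
        rw [← ENNReal.ofReal_mul hK, ← ENNReal.ofReal_add hC (mul_nonneg hK (hG.nonneg _))]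
        exact ENNReal.ofReal_le_ofReal (h _)
    _ = ENNReal.ofReal C * volume I + ENNReal.ofReal K * orliczModular G I u := by
        rw [lintegral_add_left measurable_const, lintegral_const_mul' _ _ ENNReal.ofReal_ne_top]
        simp [orliczModular]
    _ < ∞ := ENNReal.add_lt_top.2 ⟨ENNReal.mul_lt_top ENNReal.ofReal_lt_top hI.measure_lt_top,
        ENNReal.mul_lt_top ENNReal.ofReal_lt_top hu⟩

theorem modular_convex (hG : IsGFunction G) {I : Set ℝ} {a b : ℝ} (ha : 0 ≤ a) (hb : 0 ≤ b)
    (hab : a + b = 1) {u v : ℝ → EuclideanSpace ℝ (Fin N)}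
    (hu : AEMeasurable u (volume.restrict I)) :
    orliczModular G I (fun t => a • u t + b • v t) ≤
      ENNReal.ofReal a * orliczModular G I u + ENNReal.ofReal b * orliczModular G I v := by
  unfold orliczModular
  rw [← lintegral_const_mul' _ _ ENNReal.ofReal_ne_top,
    ← lintegral_const_mul' _ _ ENNReal.ofReal_ne_top, ← lintegral_add_left']
  · refine lintegral_mono fun t => ?_
    rw [← ENNReal.ofReal_mul ha, ← ENNReal.ofReal_mul hb,
      ← ENNReal.ofReal_add (mul_nonneg ha (hG.nonneg _)) (mul_nonneg hb (hG.nonneg _))]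
    exact ENNReal.ofReal_le_ofReal
      (hG.convex.2 (Set.mem_univ (u t)) (Set.mem_univ (v t)) ha hb hab)
  · exact ((hG.continuous.measurable.comp_aemeasurable hu).ennreal_ofReal).const_mul _

theorem modular_add_lt_top (hG : IsGFunction G) {I : Set ℝ} (hI : Bornology.IsBounded I)
    {u v : ℝ → EuclideanSpace ℝ (Fin N)} (hum : AEMeasurable u (volume.restrict I))
    (hu : orliczModular G I u < ∞) (hv : orliczModular G I v < ∞) :
    orliczModular G I (fun t => u t + v t) < ∞ := by
  have h := hG.modular_convex (I := I) (a := 1 / 2) (b := 1 / 2) (by norm_num) (by norm_num)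
    (by norm_num) (u := fun t => (2 : ℝ) • u t) (v := fun t => (2 : ℝ) • v t)
    (hum.const_smul (2 : ℝ) :)
  simp only [smul_smul] at h
  norm_num at h
  refine h.trans_lt (ENNReal.add_lt_top.2 ⟨ENNReal.mul_lt_top ?_ (hG.modular_smul_lt_top hI 2 hu),
    ENNReal.mul_lt_top ?_ (hG.modular_smul_lt_top hI 2 hv)⟩) <;>
  simp

end IsGFunction

theorem orliczModular_congr {N : ℕ} (G : EuclideanSpace ℝ (Fin N) → ℝ) {I : Set ℝ}
    {u v : ℝ → EuclideanSpace ℝ (Fin N)} (h : u =ᵐ[volume.restrict I] v) :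
    orliczModular G I u = orliczModular G I v :=
  lintegral_congr_ae (h.fun_comp fun x => ENNReal.ofReal (G x))

theorem luxemburgNorm_congr {N : ℕ} (G : EuclideanSpace ℝ (Fin N) → ℝ) {I : Set ℝ}
    {u v : ℝ → EuclideanSpace ℝ (Fin N)} (h : u =ᵐ[volume.restrict I] v) :
    luxemburgNorm G I u = luxemburgNorm G I v := by
  unfold luxemburgNorm
  congr 1
  ext α
  have e : orliczModular G I (fun t => α⁻¹ • u t) = orliczModular G I (fun t => α⁻¹ • v t) :=
    orliczModular_congr G (h.fun_comp fun x => α⁻¹ • x)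
  change (0 < α ∧ _ ≤ _) ↔ (0 < α ∧ _ ≤ _)
  rw [e]

/-- The Orlicz space `L^G(I, ℝ^N)`: all (classes modulo equality a.e. on `I` of) measurable
functions `u : I → ℝ^N` with `∫_I G(u) dt < ∞`. -/
def orliczSpace {N : ℕ} {G : EuclideanSpace ℝ (Fin N) → ℝ} (hG : IsGFunction G) {I : Set ℝ}
    (hI : Bornology.IsBounded I) :
    Submodule ℝ (ℝ →ₘ[volume.restrict I] EuclideanSpace ℝ (Fin N)) where
  carrier := {u | orliczModular G I u < ∞}
  zero_mem' := by
    have h := orliczModular_congr G (AEEqFun.coeFn_zero (α := ℝ) (μ := volume.restrict I)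
      (β := EuclideanSpace ℝ (Fin N)))
    change orliczModular G I _ < ∞
    rw [h]
    simp [orliczModular, hG.map_zero]
  add_mem' := by
    intro u v hu hv
    change orliczModular G I _ < ∞
    rw [orliczModular_congr G (AEEqFun.coeFn_add u v)]
    exact hG.modular_add_lt_top hI u.aemeasurable hu hv
  smul_mem' := by
    intro c u hu
    change orliczModular G I _ < ∞
    rw [orliczModular_congr G (AEEqFun.coeFn_smul c u)]
    exact hG.modular_smul_lt_top hI c hu

namespace IsGFunction

variable {N : ℕ} {G : EuclideanSpace ℝ (Fin N) → ℝ}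

theorem exists_modular_le_one (hG : IsGFunction G) {I : Set ℝ}
    {u : ℝ → EuclideanSpace ℝ (Fin N)} (hu : orliczModular G I u < ∞) :
    {α : ℝ | 0 < α ∧ orliczModular G I (fun t => α⁻¹ • u t) ≤ 1}.Nonempty := by
  set m := (orliczModular G I u).toReal
  have h1 : (1 : ℝ) ≤ max 1 m := le_max_left _ _
  have h0 : (0 : ℝ) < max 1 m := by linarith
  refine ⟨max 1 m, h0, ?_⟩
  calc orliczModular G I (fun t => (max 1 m)⁻¹ • u t)
      ≤ ∫⁻ t in I, ENNReal.ofReal (max 1 m)⁻¹ * ENNReal.ofReal (G (u t)) := by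
        refine lintegral_mono fun t => ?_
        rw [← ENNReal.ofReal_mul (inv_nonneg.2 h0.le)]
        exact ENNReal.ofReal_le_ofReal
          (hG.smul_le (inv_nonneg.2 h0.le) (inv_le_one_of_one_le₀ h1) _)
    _ = ENNReal.ofReal (max 1 m)⁻¹ * orliczModular G I u :=
        lintegral_const_mul' _ _ ENNReal.ofReal_ne_top
    _ = ENNReal.ofReal ((max 1 m)⁻¹ * m) := by
        rw [ENNReal.ofReal_mul (inv_nonneg.2 h0.le), ENNReal.ofReal_toReal hu.ne]
    _ ≤ 1 := by
        rw [← ENNReal.ofReal_one]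
        refine ENNReal.ofReal_le_ofReal ?_
        rw [inv_mul_le_iff₀ h0, mul_one]
        exact le_max_right _ _

theorem luxemburgNorm_nonneg (G : EuclideanSpace ℝ (Fin N) → ℝ) (I : Set ℝ)
    (u : ℝ → EuclideanSpace ℝ (Fin N)) : 0 ≤ luxemburgNorm G I u :=
  Real.sInf_nonneg fun _ h => h.1.le

theorem bddBelow_modular (G : EuclideanSpace ℝ (Fin N) → ℝ) (I : Set ℝ)
    (u : ℝ → EuclideanSpace ℝ (Fin N)) :
    BddBelow {α : ℝ | 0 < α ∧ orliczModular G I (fun t => α⁻¹ • u t) ≤ 1} :=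
  ⟨0, fun _ h => h.1.le⟩

theorem luxemburgNorm_add_le (hG : IsGFunction G) {I : Set ℝ}
    {u v : ℝ → EuclideanSpace ℝ (Fin N)} (hum : AEMeasurable u (volume.restrict I))
    (hu : orliczModular G I u < ∞) (hv : orliczModular G I v < ∞) :
    luxemburgNorm G I (fun t => u t + v t) ≤ luxemburgNorm G I u + luxemburgNorm G I v := by
  refine le_of_forall_pos_le_add fun ε hε => ?_
  obtain ⟨a, ⟨ha, hau⟩, ha'⟩ := exists_lt_of_csInf_lt (hG.exists_modular_le_one hu)
    (show luxemburgNorm G I u < luxemburgNorm G I u + ε / 2 by linarith)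
  obtain ⟨b, ⟨hb, hbv⟩, hb'⟩ := exists_lt_of_csInf_lt (hG.exists_modular_le_one hv)
    (show luxemburgNorm G I v < luxemburgNorm G I v + ε / 2 by linarith)
  have hab : 0 < a + b := by positivity
  have key : luxemburgNorm G I (fun t => u t + v t) ≤ a + b := by
    refine csInf_le (bddBelow_modular G I _) ⟨hab, ?_⟩
    have h := hG.modular_convex (I := I) (a := a / (a + b)) (b := b / (a + b)) (by positivity)
      (by positivity) (by field_simp) (u := fun t => a⁻¹ • u t) (v := fun t => b⁻¹ • v t)
      (hum.const_smul a⁻¹ :)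
    have e : (fun t => (a / (a + b)) • a⁻¹ • u t + (b / (a + b)) • b⁻¹ • v t) =
        fun t => (a + b)⁻¹ • (u t + v t) := by
      funext t
      rw [smul_smul, smul_smul, smul_add]
      congr 2 <;> field_simp
    rw [e] at h
    calc _ ≤ _ := h
      _ ≤ ENNReal.ofReal (a / (a + b)) * 1 + ENNReal.ofReal (b / (a + b)) * 1 := by gcongr
      _ = 1 := by
        rw [mul_one, mul_one, ← ENNReal.ofReal_add (by positivity) (by positivity), ← add_div,
          div_self hab.ne', ENNReal.ofReal_one]
  linarith

theorem luxemburgNorm_smul_le (hG : IsGFunction G) {I : Set ℝ} (c : ℝ) (hc : c ≠ 0)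
    {u : ℝ → EuclideanSpace ℝ (Fin N)} (hu : orliczModular G I u < ∞) :
    luxemburgNorm G I (fun t => c • u t) ≤ |c| * luxemburgNorm G I u := by
  have hc' : 0 < |c| := abs_pos.2 hc
  rw [← div_le_iff₀' hc']
  refine le_csInf (hG.exists_modular_le_one hu) fun a ⟨ha, hau⟩ => ?_
  rw [div_le_iff₀' hc']
  refine csInf_le (bddBelow_modular G I _) ⟨by positivity, ?_⟩
  refine le_trans (lintegral_mono fun t => ENNReal.ofReal_le_ofReal ?_) hau
  change G ((|c| * a)⁻¹ • c • u t) ≤ G (a⁻¹ • u t)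
  rw [smul_smul]
  refine hG.mono_smul (le_of_eq ?_) _
  rw [abs_mul, abs_inv, abs_mul, abs_abs, abs_inv]
  field_simp

theorem luxemburgNorm_zero (hG : IsGFunction G) (I : Set ℝ) :
    luxemburgNorm G I (fun _ => (0 : EuclideanSpace ℝ (Fin N))) = 0 := by
  refine le_antisymm (le_of_forall_pos_le_add fun ε hε => ?_) (luxemburgNorm_nonneg _ _ _)
  rw [zero_add]
  exact csInf_le (bddBelow_modular G I _) ⟨hε, by simp [orliczModular, hG.map_zero]⟩

theorem luxemburgNorm_smul (hG : IsGFunction G) {I : Set ℝ} (hI : Bornology.IsBounded I) (c : ℝ)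
    {u : ℝ → EuclideanSpace ℝ (Fin N)} (hu : orliczModular G I u < ∞) :
    luxemburgNorm G I (fun t => c • u t) = |c| * luxemburgNorm G I u := by
  rcases eq_or_ne c 0 with rfl | hc
  · simp [hG.luxemburgNorm_zero]
  · refine le_antisymm (hG.luxemburgNorm_smul_le c hc hu) ?_
    have h := hG.luxemburgNorm_smul_le c⁻¹ (inv_ne_zero hc) (hG.modular_smul_lt_top hI c hu)
    simp only [smul_smul, inv_mul_cancel₀ hc, one_smul] at h
    rwa [abs_inv, ← div_eq_inv_mul, le_div_iff₀' (abs_pos.2 hc)] at h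

theorem ae_eq_zero_of_luxemburgNorm (hG : IsGFunction G) {I : Set ℝ}
    {u : ℝ → EuclideanSpace ℝ (Fin N)} (hum : AEMeasurable u (volume.restrict I))
    (hu : orliczModular G I u < ∞) (h : luxemburgNorm G I u = 0) :
    u =ᵐ[volume.restrict I] 0 := by
  have h1 : ∀ k : ℕ, orliczModular G I (fun t => (k : ℝ) • u t) ≤ 1 := by
    intro k
    obtain ⟨a, ⟨ha, hau⟩, ha'⟩ := exists_lt_of_csInf_lt (hG.exists_modular_le_one hu)
      (show luxemburgNorm G I u < ((k : ℝ) + 1)⁻¹ by rw [h]; positivity)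
    refine le_trans (lintegral_mono fun t => ENNReal.ofReal_le_ofReal ?_) hau
    refine hG.mono_smul ?_ _
    rw [abs_of_nonneg (Nat.cast_nonneg k), abs_of_pos (inv_pos.2 ha)]
    have := (lt_inv_comm₀ ha (by positivity)).1 ha'
    linarith
  have h2 : ∀ m : ℕ, orliczModular G I (fun t => (m : ℝ) • u t) = 0 := by
    intro m
    have h3 : ∀ k : ℕ, (k : ℝ≥0∞) * orliczModular G I (fun t => (m : ℝ) • u t) ≤ 1 := by
      intro k
      rcases Nat.eq_zero_or_pos k with rfl | hk
      · simp
      refine le_trans ?_ (h1 (k * m))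
      unfold orliczModular
      rw [← lintegral_const_mul' _ _ (ENNReal.natCast_ne_top k)]
      refine lintegral_mono fun t => ?_
      rw [← ENNReal.ofReal_natCast k, ← ENNReal.ofReal_mul (Nat.cast_nonneg k), Nat.cast_mul]
      refine ENNReal.ofReal_le_ofReal ?_
      change (k : ℝ) * G ((m : ℝ) • u t) ≤ G (((k : ℝ) * m) • u t)
      rw [mul_smul]
      exact hG.le_smul (by exact_mod_cast hk) _
    by_contra h0
    obtain ⟨k, hk⟩ := ENNReal.exists_nat_mul_gt h0 ENNReal.one_ne_top
    exact absurd (h3 k) (not_le.2 hk)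
  have h4 : ∀ m : ℕ, ∀ᵐ t ∂(volume.restrict I), G ((m : ℝ) • u t) = 0 := by
    intro m
    have hm : AEMeasurable (fun t => ENNReal.ofReal (G ((m : ℝ) • u t))) (volume.restrict I) :=
      (hG.continuous.measurable.comp_aemeasurable (hum.const_smul (m : ℝ))).ennreal_ofReal
    filter_upwards [(lintegral_eq_zero_iff' hm).1 (h2 m)] with t ht
    exact le_antisymm (ENNReal.ofReal_eq_zero.1 ht) (hG.nonneg _)
  filter_upwards [ae_all_iff.2 h4] with t ht
  by_contra hne
  have hne' : 0 < ‖u t‖ := norm_pos_iff.2 hne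
  have ht1 : Tendsto (fun m : ℕ => (m : ℝ) • u t) atTop (Bornology.cobounded _) := by
    rw [← tendsto_norm_atTop_iff_cobounded]
    simp only [norm_smul, Real.norm_natCast]
    exact tendsto_natCast_atTop_atTop.atTop_mul_const hne'
  obtain ⟨m, hm⟩ := ((hG.supercoercive.comp ht1).eventually_gt_atTop 0).exists
  simp [ht m] at hm

end IsGFunction

section OrliczNorm

variable {N : ℕ} {G : EuclideanSpace ℝ (Fin N) → ℝ} (hG : IsGFunction G) {I : Set ℝ}
  (hI : Bornology.IsBounded I)

/-- The norm of `L^G(I, ℝ^N)` is the Luxemburg norm. -/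
noncomputable instance orliczSpace.instNorm : Norm (orliczSpace hG hI) where
  norm u := luxemburgNorm G I (u : ℝ →ₘ[volume.restrict I] EuclideanSpace ℝ (Fin N))

theorem orliczSpace.core : NormedSpace.Core ℝ (orliczSpace hG hI) where
  norm_nonneg u := IsGFunction.luxemburgNorm_nonneg G I _
  norm_smul c u := by
    change luxemburgNorm G I (c • u.1 : ℝ →ₘ[volume.restrict I] EuclideanSpace ℝ (Fin N)) =
      ‖c‖ * luxemburgNorm G I u.1
    rw [luxemburgNorm_congr G (AEEqFun.coeFn_smul c u.1)]
    exact hG.luxemburgNorm_smul hI c u.2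
  norm_triangle u v := by
    change luxemburgNorm G I (u.1 + v.1 : ℝ →ₘ[volume.restrict I] EuclideanSpace ℝ (Fin N)) ≤
      luxemburgNorm G I u.1 + luxemburgNorm G I v.1
    rw [luxemburgNorm_congr G (AEEqFun.coeFn_add u.1 v.1)]
    exact hG.luxemburgNorm_add_le u.1.aemeasurable u.2 v.2
  norm_eq_zero_iff u := by
    change luxemburgNorm G I u.1 = 0 ↔ u = 0
    constructor
    · intro h
      refine Subtype.ext (AEEqFun.ext ?_)
      exact (hG.ae_eq_zero_of_luxemburgNorm u.1.aemeasurable u.2 h).trans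
        AEEqFun.coeFn_zero.symm
    · rintro rfl
      have h := luxemburgNorm_congr G (AEEqFun.coeFn_zero (α := ℝ) (μ := volume.restrict I)
        (β := EuclideanSpace ℝ (Fin N)))
      exact h.trans (hG.luxemburgNorm_zero I)

noncomputable instance orliczSpace.instNormedAddCommGroup :
    NormedAddCommGroup (orliczSpace hG hI) :=
  NormedAddCommGroup.ofCore (orliczSpace.core hG hI)

noncomputable instance orliczSpace.instNormedSpace : NormedSpace ℝ (orliczSpace hG hI) :=
  NormedSpace.ofCore (orliczSpace.core hG hI)

end OrliczNorm

/-- A real normed space is reflexive if the canonical embedding into its bidual is onto. -/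
def IsReflexiveSpace (X : Type*) [NormedAddCommGroup X] [NormedSpace ℝ X] : Prop :=
  Function.Surjective (NormedSpace.inclusionInDoubleDual ℝ X)

/-! Write X for the Orlicz space. Reflexivity is proved directly, without the conjugate function of
`G`, by representing functionals by densities; completeness then follows because X is isometric to
its bidual.

A functional on bounded measurable functions that is continuous under bounded a.e. convergence has
an integrable density, by Radon–Nikodym (`exists_density`). This is used twice: for ℓ in X*,
composed with the inclusion of bounded functions into X, and for ξ in X**, composed with the pairing
that sends a bounded function v to the functional u ↦ ∫⟨v, u⟩ in X*. Continuity of the inclusion is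
dominated convergence on a set of finite measure; continuity of the pairing comes from
supercoercivity.

The main point is that the pairing has dense range in X* (`denseRange_pairing`). If ℓ has density w,
then ℓ restricted to {|w| ≤ n} is the pairing with the truncated w, so the part of ℓ living on {|w|
> n} has to vanish in norm. This is where ∇₂ enters (`exists_norm_comp_restrictTo_le`): otherwise ℓ
is at least δ on infinitely many disjointly supported elements of modular at most 1. The sum of
about (2K)^j of them has ℓ-value at least (2K)^j δ, while ∇₂ bounds its norm by a constant times
K^j, which is absurd for large j.

Given ξ in X** with density w, density of the pairing and Hahn–Banach bound the truncations of w in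
X by ‖ξ‖. Fatou and Δ₂ put w itself in X. Evaluation at w and ξ agree on the dense range of the
pairing, hence everywhere. -/

/-! ### Integral representation of functionals on bounded measurable functions -/

section BoundedMeasurable

open scoped InnerProductSpace

variable {Ω : Type*} [MeasurableSpace Ω]
  {E : Type*} [NormedAddCommGroup E] [InnerProductSpace ℝ E] [FiniteDimensional ℝ E]
  [MeasurableSpace E] [BorelSpace E]

/-- The space of bounded measurable functions with values in a Euclidean space. -/
def boundedMeasurable (Ω E : Type*) [MeasurableSpace Ω] [NormedAddCommGroup E]
    [InnerProductSpace ℝ E] [FiniteDimensional ℝ E] [MeasurableSpace E] [BorelSpace E] :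
    Submodule ℝ (Ω → E) where
  carrier := {f | Measurable f ∧ ∃ C, ∀ t, ‖f t‖ ≤ C}
  zero_mem' := ⟨measurable_zero, 0, fun _ => by simp⟩
  add_mem' := by
    rintro f g ⟨hf, C, hC⟩ ⟨hg, D, hD⟩
    exact ⟨hf.add hg, C + D, fun t => (norm_add_le _ _).trans (add_le_add (hC t) (hD t))⟩
  smul_mem' := by
    rintro c f ⟨hf, C, hC⟩
    refine ⟨hf.const_smul c, ‖c‖ * C, fun t => ?_⟩
    rw [Pi.smul_apply, norm_smul]
    exact mul_le_mul_of_nonneg_left (hC t) (norm_nonneg _)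

namespace boundedMeasurable

theorem indicator_mem {f : Ω → E} (hf : f ∈ boundedMeasurable Ω E) {A : Set Ω}
    (hA : MeasurableSet A) : A.indicator f ∈ boundedMeasurable Ω E := by
  obtain ⟨hm, C, hC⟩ := hf
  exact ⟨hm.indicator hA, C, fun t => (norm_indicator_le_norm_self _ _).trans (hC t)⟩

theorem const_mem (c : E) : (fun _ => c) ∈ boundedMeasurable Ω E :=
  ⟨measurable_const, ‖c‖, fun _ => le_rfl⟩

theorem simpleFunc_mem (f : SimpleFunc Ω E) : ⇑f ∈ boundedMeasurable Ω E :=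
  ⟨f.measurable, f.exists_forall_norm_le⟩

/-- The truncation of a measurable function to the set where its norm is at most `n`. -/
theorem truncation_mem {w : Ω → E} (hw : Measurable w) (n : ℕ) :
    {t | ‖w t‖ ≤ n}.indicator w ∈ boundedMeasurable Ω E := by
  refine ⟨hw.indicator (hw.norm measurableSet_Iic), n, fun t => ?_⟩
  by_cases ht : ‖w t‖ ≤ n
  · rw [Set.indicator_of_mem (show t ∈ {t | ‖w t‖ ≤ n} from ht)]
    exact ht
  · rw [Set.indicator_of_notMem (show t ∉ {t | ‖w t‖ ≤ n} from ht), norm_zero]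
    exact n.cast_nonneg

/-- A linear functional on bounded measurable functions that is continuous with respect to
bounded almost everywhere convergence. -/
def IsDominatedContinuous (μ : Measure Ω) (T : boundedMeasurable Ω E →ₗ[ℝ] ℝ) : Prop :=
  ∀ (f : ℕ → boundedMeasurable Ω E) (g : boundedMeasurable Ω E) (C : ℝ),
    (∀ n t, ‖(f n : Ω → E) t‖ ≤ C) →
    (∀ᵐ t ∂μ, Tendsto (fun n => (f n : Ω → E) t) atTop (𝓝 ((g : Ω → E) t))) →
    Tendsto (fun n => T (f n)) atTop (𝓝 (T g))

variable {μ : Measure Ω} {T : boundedMeasurable Ω E →ₗ[ℝ] ℝ}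

/-- The constant sequence `f` converges a.e. to 0. This supplies the absolute continuity required
for Radon–Nikodym. -/
theorem IsDominatedContinuous.map_eq_zero (hT : IsDominatedContinuous μ T)
    {f : boundedMeasurable Ω E} (hf : (f : Ω → E) =ᵐ[μ] 0) : T f = 0 := by
  obtain ⟨-, C, hC⟩ := f.2
  have h := hT (fun _ => f) 0 C (fun _ => hC) (by
    filter_upwards [hf] with t ht
    simp [ht])
  rw [map_zero] at h
  exact tendsto_nhds_unique tendsto_const_nhds h

/-- The bounded function `A.indicator c`. -/
noncomputable def indicatorConst (A : Set Ω) (hA : MeasurableSet A) (c : E) : boundedMeasurable Ω E :=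
  ⟨A.indicator fun _ => c, indicator_mem (const_mem c) hA⟩

open Classical in
/-- The signed measure `A ↦ T (1_A c)`. -/
noncomputable def IsDominatedContinuous.signedMeasure (hT : IsDominatedContinuous μ T) (c : E) :
    SignedMeasure Ω where
  measureOf' A := if hA : MeasurableSet A then T (indicatorConst A hA c) else 0
  empty' := by
    rw [dif_pos MeasurableSet.empty, ← map_zero T]
    congr 1
    ext t
    simp [indicatorConst]
  not_measurable' A hA := dif_neg hA
  m_iUnion' A hA hd := by
    rw [dif_pos (MeasurableSet.iUnion hA)]
    simp only [hA, dif_pos]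
    -- Unconditional summability is a limit along finite subsets of ℕ, a countably generated filter,
    -- so it can be tested on sequences, the only objects that `hT` speaks about.
    refine tendsto_of_seq_tendsto fun s hs => ?_
    simp only [Function.comp_def, ← map_sum]
    have key : ∀ (s : Finset ℕ) t, ((∑ i ∈ s, indicatorConst (A i) (hA i) c :
        boundedMeasurable Ω E) : Ω → E) t = (⋃ i ∈ s, A i).indicator (fun _ => c) t := by
      intro s t
      rw [Finset.indicator_biUnion s A fun i _ j _ hij => hd hij]
      simp [indicatorConst, Finset.sum_apply]
    refine hT _ _ ‖c‖ (fun n t => ?_) (ae_of_all _ fun t => ?_)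
    · rw [key]
      exact norm_indicator_le_norm_self _ _
    · simp only [key]
      by_cases ht : ∃ i, t ∈ A i
      · obtain ⟨i, hi⟩ := ht
        refine tendsto_const_nhds.congr' ?_
        filter_upwards [hs.eventually (eventually_ge_atTop {i})] with n hn
        have h1 : t ∈ ⋃ i ∈ s n, A i := by
          simp only [Set.mem_iUnion]
          exact ⟨i, hn (Finset.mem_singleton_self i), hi⟩
        rw [Set.indicator_of_mem h1]
        exact Set.indicator_of_mem (Set.mem_iUnion.2 ⟨i, hi⟩) fun _ => c
      · refine tendsto_const_nhds.congr fun n => ?_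
        have h1 : t ∉ ⋃ i ∈ s n, A i := by
          simp only [Set.mem_iUnion]
          exact fun ⟨i, _, hi⟩ => ht ⟨i, hi⟩
        rw [Set.indicator_of_notMem h1]
        exact Set.indicator_of_notMem (fun h => ht (Set.mem_iUnion.1 h)) fun _ => c

theorem IsDominatedContinuous.signedMeasure_apply (hT : IsDominatedContinuous μ T) (c : E)
    {A : Set Ω} (hA : MeasurableSet A) :
    hT.signedMeasure c A = T (indicatorConst A hA c) :=
  dif_pos hA

theorem IsDominatedContinuous.exists_density_indicator [SigmaFinite μ]
    (hT : IsDominatedContinuous μ T) (c : E) :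
    ∃ w : Ω → ℝ, Measurable w ∧ Integrable w μ ∧ ∀ (A : Set Ω) (hA : MeasurableSet A),
      T (indicatorConst A hA c) = ∫ t in A, w t ∂μ := by
  have hac : hT.signedMeasure c ≪ᵥ μ.toENNRealVectorMeasure := by
    refine VectorMeasure.AbsolutelyContinuous.mk fun A hA h0 => ?_
    rw [Measure.toENNRealVectorMeasure_apply_measurable hA] at h0
    rw [hT.signedMeasure_apply c hA]
    exact hT.map_eq_zero (indicator_meas_zero h0)
  refine ⟨(hT.signedMeasure c).rnDeriv μ, SignedMeasure.measurable_rnDeriv _ _,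
    SignedMeasure.integrable_rnDeriv _ _, fun A hA => ?_⟩
  rw [← hT.signedMeasure_apply c hA, ← withDensityᵥ_apply (SignedMeasure.integrable_rnDeriv _ _) hA,
    SignedMeasure.withDensityᵥ_rnDeriv_eq _ _ hac]

theorem integrable_inner {w : Ω → E} (hw : Integrable w μ) (f : boundedMeasurable Ω E) :
    Integrable (fun t => ⟪w t, (f : Ω → E) t⟫_ℝ) μ := by
  obtain ⟨hm, C, hC⟩ := f.2
  refine (hw.norm.const_mul C).mono' (hw.1.inner hm.aestronglyMeasurable)
    (ae_of_all _ fun t => (norm_inner_le_norm _ _).trans ?_)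
  rw [mul_comm]
  exact mul_le_mul_of_nonneg_right (hC t) (norm_nonneg _)

theorem isDominatedContinuous_integral_inner {w : Ω → E} (hw : Integrable w μ)
    (f : ℕ → boundedMeasurable Ω E) (g : boundedMeasurable Ω E) (C : ℝ)
    (hC : ∀ n t, ‖(f n : Ω → E) t‖ ≤ C)
    (hfg : ∀ᵐ t ∂μ, Tendsto (fun n => (f n : Ω → E) t) atTop (𝓝 ((g : Ω → E) t))) :
    Tendsto (fun n => ∫ t, ⟪w t, (f n : Ω → E) t⟫_ℝ ∂μ) atTop
      (𝓝 (∫ t, ⟪w t, (g : Ω → E) t⟫_ℝ ∂μ)) := by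
  refine tendsto_integral_of_dominated_convergence (fun t => C * ‖w t‖)
    (fun n => (integrable_inner hw (f n)).1) (hw.norm.const_mul C)
    (fun n => ae_of_all _ fun t => (norm_inner_le_norm _ _).trans ?_) ?_
  · rw [mul_comm]
    exact mul_le_mul_of_nonneg_right (hC n t) (norm_nonneg _)
  · filter_upwards [hfg] with t ht
    exact tendsto_const_nhds.inner ht

/-- A functional that is continuous under bounded almost everywhere convergence is represented by
an integrable density. -/
theorem IsDominatedContinuous.exists_density [SigmaFinite μ] (hT : IsDominatedContinuous μ T) :
    ∃ w : Ω → E, Measurable w ∧ Integrable w μ ∧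
      ∀ f : boundedMeasurable Ω E, T f = ∫ t, ⟪w t, (f : Ω → E) t⟫_ℝ ∂μ := by
  let b := stdOrthonormalBasis ℝ E
  choose v hvm hvi hv using fun i => hT.exists_density_indicator (b i)
  let w : Ω → E := fun t => ∑ i, v i t • b i
  have hwi : Integrable w μ := integrable_finsetSum _ fun i _ => (hvi i).smul_const (b i)
  have hind : ∀ (A : Set Ω) (hA : MeasurableSet A) (c : E), T (indicatorConst A hA c) =
      ∫ t, ⟪w t, (indicatorConst A hA c : Ω → E) t⟫_ℝ ∂μ := by
    intro A hA c
    -- Expanding `c` in the orthonormal basis reduces the vector case to the scalar densities `v i`.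
    have h1 : indicatorConst A hA c = ∑ i, ⟪b i, c⟫_ℝ • indicatorConst A hA (b i) := by
      ext t
      by_cases ht : t ∈ A
      · simp [indicatorConst, ht, Finset.sum_apply, b.sum_repr' c]
      · simp [indicatorConst, ht, Finset.sum_apply]
    have h2 : ∀ t, ⟪w t, (indicatorConst A hA c : Ω → E) t⟫_ℝ =
        A.indicator (fun t => ∑ i, ⟪b i, c⟫_ℝ * v i t) t := by
      intro t
      by_cases ht : t ∈ A
      · simp [indicatorConst, ht, w, sum_inner, real_inner_smul_left, mul_comm]
      · simp [indicatorConst, ht]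
    simp_rw [h2]
    rw [integral_indicator hA, integral_finsetSum _ fun i _ => ((hvi i).const_mul _).integrableOn,
      h1, map_sum]
    simp_rw [map_smul, hv, integral_const_mul, smul_eq_mul]
  have hsimple : ∀ f : SimpleFunc Ω E, T ⟨f, simpleFunc_mem f⟩ = ∫ t, ⟪w t, f t⟫_ℝ ∂μ := by
    intro f
    induction f using SimpleFunc.induction with
    | const c hs =>
      rename_i A
      have e : ⇑(SimpleFunc.piecewise A hs (SimpleFunc.const Ω c) (SimpleFunc.const Ω 0)) =
          A.indicator fun _ => c := by
        ext t
        by_cases ht : t ∈ A <;> simp [SimpleFunc.coe_piecewise, ht]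
      simp only [e]
      exact hind A hs c
    | add _ hf hg =>
      rename_i f g _
      have e : (⟨_, simpleFunc_mem (f + g)⟩ : boundedMeasurable Ω E) =
        ⟨_, simpleFunc_mem f⟩ + ⟨_, simpleFunc_mem g⟩ := rfl
      rw [e, map_add, hf, hg, ← integral_add (integrable_inner hwi ⟨_, simpleFunc_mem f⟩)
        (integrable_inner hwi ⟨_, simpleFunc_mem g⟩)]
      simp [inner_add_right]
  refine ⟨w, by fun_prop, hwi, fun f => ?_⟩
  obtain ⟨hm, C, hC⟩ := f.2
  -- The bound `C` may be negative when `Ω` is empty, hence the maximum with 0.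
  have hC0 : 0 ≤ max C 0 := le_max_right _ _
  have hs := hm.stronglyMeasurable
  let F : ℕ → boundedMeasurable Ω E := fun n => ⟨_, simpleFunc_mem (hs.approxBounded (max C 0) n)⟩
  have hF : ∀ n t, ‖(F n : Ω → E) t‖ ≤ max C 0 := hs.norm_approxBounded_le hC0
  have hlim : ∀ᵐ t ∂μ, Tendsto (fun n => (F n : Ω → E) t) atTop (𝓝 ((f : Ω → E) t)) :=
    ae_of_all _ fun t => hs.tendsto_approxBounded_of_norm_le ((hC t).trans (le_max_left _ _))
  refine tendsto_nhds_unique (hT F f _ hF hlim) ?_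
  refine (isDominatedContinuous_integral_inner hwi F f _ hF hlim).congr fun n => ?_
  exact (hsimple _).symm

end boundedMeasurable

end BoundedMeasurable

/-! ### Global forms of the growth conditions -/

namespace IsGFunction

variable {N : ℕ} {G : EuclideanSpace ℝ (Fin N) → ℝ}

/-- Supercoercivity makes `‖x‖ ≤ ε * G x` outside a large ball; `R` pays for the ball. Being free to
take ε small is what later makes the pairing continuous. -/
theorem exists_norm_le (hG : IsGFunction G) {ε : ℝ} (hε : 0 < ε) :
    ∃ R : ℝ, 0 ≤ R ∧ ∀ x, ‖x‖ ≤ R + ε * G x := by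
  have h := hG.supercoercive.eventually_ge_atTop ε⁻¹
  obtain ⟨R, hR⟩ := ((hasBasis_cobounded_norm (E := EuclideanSpace ℝ (Fin N))).eventually_iff).1 h
  refine ⟨max R 0, le_max_right _ _, fun x => ?_⟩
  have hx := mul_nonneg hε.le (hG.nonneg x)
  rcases lt_or_ge ‖x‖ (max R 0) with h1 | h1
  · linarith
  · have h2 := hR.2 ((le_max_left R 0).trans h1)
    rcases (norm_nonneg x).eq_or_lt with h3 | h3
    · rw [← h3]
      exact add_nonneg (le_max_right _ _) hx
    · rw [le_div_iff₀ h3, inv_mul_le_iff₀ hε] at h2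
      exact h2.trans (le_add_of_nonneg_left (le_max_right _ _))

theorem exists_le_of_norm_le (hG : IsGFunction G) (C : ℝ) :
    ∃ D : ℝ, 0 ≤ D ∧ ∀ x, ‖x‖ ≤ C → G x ≤ D := by
  obtain ⟨D, hD⟩ := (isCompact_closedBall (0 : EuclideanSpace ℝ (Fin N)) C).bddAbove_image
    hG.continuous.continuousOn
  exact ⟨max D 0, le_max_right _ _, fun x hx =>
    (hD (Set.mem_image_of_mem G (mem_closedBall_zero_iff.2 hx))).trans (le_max_left _ _)⟩

/-- Iterating ∇₂ gains a factor 2 over homogeneity at each step. Since `K ≥ 1`, dilation never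
re-enters the ball where ∇₂ may fail. If the contracted point lies in that ball, `G` there is
bounded by compactness, so `C` does not depend on `j`. -/
theorem exists_inv_pow_smul_le (hG : IsGFunction G) :
    ∃ K : ℝ, 1 ≤ K ∧ ∃ C : ℝ, 0 ≤ C ∧
      ∀ (j : ℕ) x, G ((K ^ j)⁻¹ • x) ≤ ((2 * K) ^ j)⁻¹ * G x + C := by
  obtain ⟨K, hK, M, -, h⟩ := hG.nabla2
  have hK0 : 0 < K := by linarith
  obtain ⟨C, hC, hCM⟩ := hG.exists_le_of_norm_le M
  have key : ∀ (j : ℕ) x, M ≤ ‖x‖ → G x ≤ ((2 * K) ^ j)⁻¹ * G (K ^ j • x) := by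
    intro j
    induction j with
    | zero => intro x _; simp
    | succ j ih =>
      intro x hx
      have h1 : M ≤ ‖K ^ j • x‖ := by
        rw [norm_smul, Real.norm_of_nonneg (by positivity)]
        exact hx.trans (le_mul_of_one_le_left (norm_nonneg _) (one_le_pow₀ hK))
      calc G x ≤ ((2 * K) ^ j)⁻¹ * G (K ^ j • x) := ih x hx
        _ ≤ ((2 * K) ^ j)⁻¹ * (1 / (2 * K) * G (K • K ^ j • x)) := by gcongr; exact h _ h1
        _ = ((2 * K) ^ (j + 1))⁻¹ * G (K ^ (j + 1) • x) := by
          rw [smul_smul, ← pow_succ', pow_succ (2 * K) j, mul_inv, one_div, mul_assoc]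
  refine ⟨K, hK, C, hC, fun j x => ?_⟩
  rcases le_total M ‖(K ^ j)⁻¹ • x‖ with hx | hx
  · have h1 := key j _ hx
    rw [smul_smul, mul_inv_cancel₀ (by positivity), one_smul] at h1
    linarith
  · have h1 := hCM _ hx
    have h2 : 0 ≤ ((2 * K) ^ j)⁻¹ * G x := mul_nonneg (by positivity) (hG.nonneg x)
    linarith

theorem measurable_modular_integrand (hG : IsGFunction G) {μ : Measure ℝ}
    {u : ℝ → EuclideanSpace ℝ (Fin N)} (hu : AEMeasurable u μ) :
    AEMeasurable (fun t => ENNReal.ofReal (G (u t))) μ :=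
  (hG.continuous.measurable.comp_aemeasurable hu).ennreal_ofReal

theorem modular_lt_top_of_bounded (hG : IsGFunction G) {I : Set ℝ} (hI : Bornology.IsBounded I)
    {f : ℝ → EuclideanSpace ℝ (Fin N)} {C : ℝ} (hf : ∀ t, ‖f t‖ ≤ C) :
    orliczModular G I f < ∞ := by
  obtain ⟨D, -, hD⟩ := hG.exists_le_of_norm_le C
  calc orliczModular G I f ≤ ∫⁻ _ in I, ENNReal.ofReal D :=
        lintegral_mono fun t => ENNReal.ofReal_le_ofReal (hD _ (hf t))
    _ = ENNReal.ofReal D * volume I := by simp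
    _ < ∞ := ENNReal.mul_lt_top ENNReal.ofReal_lt_top hI.measure_lt_top

end IsGFunction

theorem LinearMap.norm_le_mul_norm_of_unit_ball {X : Type*} [SeminormedAddCommGroup X]
    [NormedSpace ℝ X] (f : X →ₗ[ℝ] ℝ) {B : ℝ} (h : ∀ u, ‖u‖ < 1 → |f u| ≤ B) (u : X) :
    ‖f u‖ ≤ B * ‖u‖ := by
  have hB : 0 ≤ B := (abs_nonneg _).trans (h 0 (by simp))
  refine le_of_forall_pos_le_add fun ε hε => ?_
  -- Scaling by slightly more than `‖u‖` lands strictly inside the unit ball and also covers `‖u‖ =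
  -- 0`; the error costs `B * (ε / (B + 1)) ≤ ε`.
  have hc : 0 < ‖u‖ + ε / (B + 1) := by positivity
  have h1 := h ((‖u‖ + ε / (B + 1))⁻¹ • u) (by
    rw [norm_smul, norm_inv, Real.norm_of_nonneg hc.le, inv_mul_lt_iff₀ hc, mul_one]
    linarith [show 0 < ε / (B + 1) by positivity])
  rw [map_smul, smul_eq_mul, abs_mul, abs_inv, abs_of_pos hc, inv_mul_le_iff₀ hc] at h1
  rw [Real.norm_eq_abs]
  have h2 : B * (ε / (B + 1)) ≤ ε := by
    rw [mul_div_assoc', div_le_iff₀ (by positivity)]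
    nlinarith
  nlinarith

/-! ### Norm versus modular, restriction to sets, density of bounded functions -/

namespace orliczSpace

open scoped InnerProductSpace

variable {N : ℕ} {G : EuclideanSpace ℝ (Fin N) → ℝ} {hG : IsGFunction G} {I : Set ℝ}
  {hI : Bornology.IsBounded I}

theorem norm_le_of_modular_le_one (u : orliczSpace hG hI) {α : ℝ} (hα : 0 < α)
    (h : orliczModular G I (fun t => α⁻¹ • u.1 t) ≤ 1) : ‖u‖ ≤ α :=
  csInf_le (IsGFunction.bddBelow_modular G I _) ⟨hα, h⟩

theorem modular_le_one_of_norm_lt (u : orliczSpace hG hI) {α : ℝ} (h : ‖u‖ < α) :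
    orliczModular G I (fun t => α⁻¹ • u.1 t) ≤ 1 := by
  obtain ⟨a, ⟨ha, hau⟩, ha'⟩ := exists_lt_of_csInf_lt (hG.exists_modular_le_one u.2) h
  refine le_trans (lintegral_mono fun t => ENNReal.ofReal_le_ofReal (hG.mono_smul ?_ _)) hau
  rw [abs_of_pos (inv_pos.2 (ha.trans ha')), abs_of_pos (inv_pos.2 ha)]
  exact inv_anti₀ ha ha'.le

theorem modular_le_one_of_norm_lt_one (u : orliczSpace hG hI) (h : ‖u‖ < 1) :
    orliczModular G I u.1 ≤ 1 := by
  simpa using modular_le_one_of_norm_lt u h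

/-- Convexity and `G 0 = 0` give `G (C⁻¹ • x) ≤ C⁻¹ * G x`, so dividing by a further `C` brings the
modular down to 1. -/
theorem norm_le_of_modular_le (u : orliczSpace hG hI) {α C : ℝ} (hα : 0 < α) (hC : 1 ≤ C)
    (h : orliczModular G I (fun t => α⁻¹ • u.1 t) ≤ ENNReal.ofReal C) : ‖u‖ ≤ α * C := by
  have hC0 : 0 < C := by linarith
  refine norm_le_of_modular_le_one u (by positivity) ?_
  calc orliczModular G I (fun t => (α * C)⁻¹ • u.1 t)
      ≤ ∫⁻ t in I, ENNReal.ofReal C⁻¹ * ENNReal.ofReal (G (α⁻¹ • u.1 t)) := by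
        refine lintegral_mono fun t => ?_
        have h := hG.smul_le (inv_nonneg.2 hC0.le) (inv_le_one_of_one_le₀ hC) (α⁻¹ • u.1 t)
        rw [smul_smul, ← mul_inv, mul_comm C α] at h
        rw [← ENNReal.ofReal_mul (inv_nonneg.2 hC0.le)]
        exact ENNReal.ofReal_le_ofReal h
    _ = ENNReal.ofReal C⁻¹ * orliczModular G I (fun t => α⁻¹ • u.1 t) :=
        lintegral_const_mul' _ _ ENNReal.ofReal_ne_top
    _ ≤ ENNReal.ofReal C⁻¹ * ENNReal.ofReal C := by gcongr
    _ = 1 := by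
        rw [← ENNReal.ofReal_mul (inv_nonneg.2 hC0.le), inv_mul_cancel₀ hC0.ne', ENNReal.ofReal_one]

theorem tendsto_zero_of_modular {w : ℕ → orliczSpace hG hI}
    (h : ∀ c : ℝ, Tendsto (fun n => orliczModular G I (fun t => c • (w n).1 t)) atTop (𝓝 0)) :
    Tendsto w atTop (𝓝 0) := by
  rw [Metric.tendsto_atTop']
  intro ε hε
  obtain ⟨n, hn⟩ := eventually_atTop.1 ((h (ε / 2)⁻¹).eventually_le_const zero_lt_one)
  refine ⟨n, fun m hm => ?_⟩
  rw [dist_zero_right]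
  exact (norm_le_of_modular_le_one (w m) (half_pos hε) (hn m hm.le)).trans_lt (half_lt_self hε)

/-- Dominated convergence in the Orlicz space. -/
theorem tendsto_zero_of_dominated {w : ℕ → orliczSpace hG hI} {b : ℝ → ℝ → ℝ≥0∞}
    (hb : ∀ c, ∫⁻ t in I, b c t ≠ ∞)
    (hwb : ∀ c n, ∀ᵐ t ∂(volume.restrict I), ENNReal.ofReal (G (c • (w n).1 t)) ≤ b c t)
    (hw : ∀ᵐ t ∂(volume.restrict I), Tendsto (fun n => (w n).1 t) atTop (𝓝 0)) :
    Tendsto w atTop (𝓝 0) := by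
  refine tendsto_zero_of_modular fun c => ?_
  have h := tendsto_lintegral_of_dominated_convergence' (μ := volume.restrict I)
    (F := fun n t => ENNReal.ofReal (G (c • (w n).1 t))) (f := fun _ => 0) (b c)
    (fun n => hG.measurable_modular_integrand ((w n).1.aemeasurable.const_smul c)) (hwb c) (hb c) (by
      filter_upwards [hw] with t ht
      have h1 := (hG.continuous.tendsto _).comp (ht.const_smul c)
      rw [smul_zero, hG.map_zero] at h1
      simpa using ENNReal.tendsto_ofReal h1)
  simpa [orliczModular] using h

variable (hG hI) in
/-- Bounded measurable functions as elements of the Orlicz space. -/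
noncomputable def ofBounded :
    boundedMeasurable ℝ (EuclideanSpace ℝ (Fin N)) →ₗ[ℝ] orliczSpace hG hI where
  toFun f := ⟨AEEqFun.mk f f.2.1.aestronglyMeasurable, by
    obtain ⟨-, C, hC⟩ := f.2
    change orliczModular G I _ < ∞
    rw [orliczModular_congr G (AEEqFun.coeFn_mk _ _)]
    exact hG.modular_lt_top_of_bounded hI hC⟩
  map_add' f g := rfl
  map_smul' c f := rfl

theorem coeFn_ofBounded (f : boundedMeasurable ℝ (EuclideanSpace ℝ (Fin N))) :
    (ofBounded hG hI f).1 =ᵐ[volume.restrict I] (f : ℝ → EuclideanSpace ℝ (Fin N)) :=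
  AEEqFun.coeFn_mk _ _

theorem modular_indicator_le (A : Set ℝ) (u : ℝ → EuclideanSpace ℝ (Fin N)) (c : ℝ)
    (hG : IsGFunction G) :
    orliczModular G I (fun t => c • A.indicator u t) ≤ orliczModular G I (fun t => c • u t) := by
  refine lintegral_mono fun t => ENNReal.ofReal_le_ofReal ?_
  by_cases ht : t ∈ A
  · simp [ht]
  · simp [ht, hG.map_zero, hG.nonneg]

/-- The linear map underlying `restrictTo`. -/
noncomputable def restrictToLin (A : Set ℝ) (hA : MeasurableSet A) :
    orliczSpace hG hI →ₗ[ℝ] orliczSpace hG hI where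
  toFun u := ⟨AEEqFun.mk (A.indicator u.1) (u.1.aestronglyMeasurable.indicator hA), by
    change orliczModular G I _ < ∞
    rw [orliczModular_congr G (AEEqFun.coeFn_mk _ _)]
    have h := modular_indicator_le (I := I) A u.1 1 hG
    simp only [one_smul] at h
    exact h.trans_lt u.2⟩
  map_add' u v := by
    refine Subtype.ext (AEEqFun.mk_eq_mk.2 ?_)
    filter_upwards [AEEqFun.coeFn_add u.1 v.1] with t ht
    by_cases h : t ∈ A
    · simpa [h] using ht
    · simp [h]
  map_smul' c u := by
    refine Subtype.ext (AEEqFun.mk_eq_mk.2 ?_)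
    filter_upwards [AEEqFun.coeFn_smul c u.1] with t ht
    by_cases h : t ∈ A
    · simpa [h] using ht
    · simp [h]

theorem coeFn_restrictToLin (A : Set ℝ) (hA : MeasurableSet A) (u : orliczSpace hG hI) :
    (restrictToLin A hA u).1 =ᵐ[volume.restrict I] A.indicator u.1 :=
  AEEqFun.coeFn_mk _ _

theorem norm_restrictToLin_le (A : Set ℝ) (hA : MeasurableSet A) (u : orliczSpace hG hI) :
    ‖restrictToLin A hA u‖ ≤ 1 * ‖u‖ := by
  rw [one_mul]
  refine le_of_forall_gt_imp_ge_of_dense fun α hα => ?_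
  refine norm_le_of_modular_le_one _ ((norm_nonneg u).trans_lt hα) ?_
  refine (orliczModular_congr G ((coeFn_restrictToLin A hA u).fun_comp (α⁻¹ • ·))).trans_le ?_
  exact (modular_indicator_le A u.1 α⁻¹ hG).trans (modular_le_one_of_norm_lt u hα)

/-- Multiplication by the indicator function of a measurable set. -/
noncomputable def restrictTo (A : Set ℝ) (hA : MeasurableSet A) :
    orliczSpace hG hI →L[ℝ] orliczSpace hG hI :=
  (restrictToLin A hA).mkContinuous 1 (norm_restrictToLin_le A hA)

theorem coeFn_restrictTo (A : Set ℝ) (hA : MeasurableSet A) (u : orliczSpace hG hI) :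
    (restrictTo A hA u).1 =ᵐ[volume.restrict I] A.indicator u.1 :=
  coeFn_restrictToLin A hA u

theorem norm_restrictTo_le (A : Set ℝ) (hA : MeasurableSet A) :
    ‖(restrictTo A hA : orliczSpace hG hI →L[ℝ] orliczSpace hG hI)‖ ≤ 1 :=
  LinearMap.mkContinuous_norm_le _ zero_le_one _

theorem eq_of_coeFn {u v : orliczSpace hG hI} (h : u.1 =ᵐ[volume.restrict I] v.1) : u = v :=
  Subtype.ext (AEEqFun.ext h)

theorem restrictTo_restrictTo (A B : Set ℝ) (hA : MeasurableSet A) (hB : MeasurableSet B)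
    (u : orliczSpace hG hI) :
    restrictTo A hA (restrictTo B hB u) = restrictTo (A ∩ B) (hA.inter hB) u := by
  refine eq_of_coeFn ?_
  filter_upwards [coeFn_restrictTo A hA (restrictTo B hB u), coeFn_restrictTo B hB u,
    coeFn_restrictTo (A ∩ B) (hA.inter hB) u] with t h1 h2 h3
  rw [h1, h3, ← Set.indicator_indicator]
  by_cases ht : t ∈ A <;> simp [ht, h2]

theorem restrictTo_add_compl (A : Set ℝ) (hA : MeasurableSet A) (u : orliczSpace hG hI) :
    restrictTo A hA u + restrictTo Aᶜ hA.compl u = u := by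
  refine eq_of_coeFn ?_
  filter_upwards [AEEqFun.coeFn_add (restrictTo A hA u).1 (restrictTo Aᶜ hA.compl u).1,
    coeFn_restrictTo A hA u, coeFn_restrictTo Aᶜ hA.compl u] with t h1 h2 h3
  refine h1.trans ?_
  rw [Pi.add_apply, h2, h3]
  by_cases ht : t ∈ A <;> simp [ht]

/-- The integrands are dominated by `G (c • u)`, which is integrable for every `c` because of Δ₂. -/
theorem tendsto_restrictTo_zero {A : ℕ → Set ℝ} (hA : ∀ n, MeasurableSet (A n))
    (hlim : ∀ t, ∀ᶠ n in atTop, t ∉ A n) (u : orliczSpace hG hI) :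
    Tendsto (fun n => restrictTo (A n) (hA n) u) atTop (𝓝 0) := by
  refine tendsto_zero_of_dominated (b := fun c t => ENNReal.ofReal (G (c • u.1 t)))
    (fun c => (hG.modular_smul_lt_top hI c u.2).ne) (fun c n => ?_) ?_
  · filter_upwards [coeFn_restrictTo (A n) (hA n) u] with t ht
    rw [ht]
    refine ENNReal.ofReal_le_ofReal ?_
    by_cases h : t ∈ A n <;> simp [h, hG.map_zero, hG.nonneg]
  · filter_upwards [ae_all_iff.2 fun n => coeFn_restrictTo (A n) (hA n) u] with t ht
    refine tendsto_const_nhds.congr' ?_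
    filter_upwards [hlim t] with n hn
    rw [ht, Set.indicator_of_notMem hn]

theorem tendsto_ofBounded {f : ℕ → boundedMeasurable ℝ (EuclideanSpace ℝ (Fin N))}
    {g : boundedMeasurable ℝ (EuclideanSpace ℝ (Fin N))} {C : ℝ}
    (hC : ∀ n t, ‖(f n : ℝ → EuclideanSpace ℝ (Fin N)) t‖ ≤ C)
    (hfg : ∀ᵐ t ∂(volume.restrict I), Tendsto
      (fun n => (f n : ℝ → EuclideanSpace ℝ (Fin N)) t) atTop (𝓝 (g.1 t))) :
    Tendsto (fun n => ofBounded hG hI (f n)) atTop (𝓝 (ofBounded hG hI g)) := by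
  obtain ⟨-, D, hD⟩ := g.2
  rw [← tendsto_sub_nhds_zero_iff]
  simp_rw [← map_sub]
  choose B hB0 hB using fun c : ℝ => hG.exists_le_of_norm_le (|c| * (C + D))
  refine tendsto_zero_of_dominated (b := fun c _ => ENNReal.ofReal (B c)) (fun c => ?_)
    (fun c n => ?_) ?_
  · rw [lintegral_const, Measure.restrict_apply_univ]
    exact (ENNReal.mul_lt_top ENNReal.ofReal_lt_top hI.measure_lt_top).ne
  · filter_upwards [coeFn_ofBounded (hG := hG) (hI := hI) (f n - g)] with t ht
    rw [ht]
    refine ENNReal.ofReal_le_ofReal (hB c _ ?_)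
    rw [norm_smul, Real.norm_eq_abs]
    gcongr
    exact (norm_sub_le _ _).trans (add_le_add (hC n t) (hD t))
  · filter_upwards [ae_all_iff.2 fun n => coeFn_ofBounded (hG := hG) (hI := hI) (f n - g), hfg]
      with t ht h
    simp_rw [ht]
    exact tendsto_sub_nhds_zero_iff.2 h

theorem exists_measurable_rep (u : orliczSpace hG hI) :
    ∃ f : ℝ → EuclideanSpace ℝ (Fin N), Measurable f ∧ u.1 =ᵐ[volume.restrict I] f :=
  ⟨u.1.aemeasurable.mk _, u.1.aemeasurable.measurable_mk, u.1.aemeasurable.ae_eq_mk⟩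

/-- Truncate a measurable representative where its norm exceeds `n`; the removed part lives on sets
that every point eventually leaves. -/
theorem denseRange_ofBounded : DenseRange (ofBounded hG hI) := by
  intro u
  obtain ⟨f, hf, huf⟩ := exists_measurable_rep u
  let A : ℕ → Set ℝ := fun n => {t | ‖f t‖ ≤ n}
  have hA : ∀ n, MeasurableSet (A n) := fun n => hf.norm measurableSet_Iic
  have hlim : ∀ t, ∀ᶠ n in atTop, t ∉ (A n)ᶜ := by
    intro t
    obtain ⟨n, hn⟩ := exists_nat_ge ‖f t‖
    filter_upwards [eventually_ge_atTop n] with m hm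
    exact fun h => h (hn.trans (Nat.cast_le.2 hm))
  have h := tendsto_restrictTo_zero (fun n => (hA n).compl) hlim u
  have h2 : Tendsto (fun n => restrictTo (A n) (hA n) u) atTop (𝓝 u) := by
    have h3 := (tendsto_const_nhds (x := u)).sub h
    rw [sub_zero] at h3
    refine h3.congr fun n => ?_
    rw [sub_eq_iff_eq_add]
    exact (restrictTo_add_compl _ _ u).symm
  refine mem_closure_of_tendsto h2 (Eventually.of_forall fun n => ?_)
  refine ⟨⟨_, boundedMeasurable.truncation_mem hf n⟩, eq_of_coeFn ?_⟩
  refine (coeFn_ofBounded _).trans ?_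
  filter_upwards [coeFn_restrictTo (A n) (hA n) u, huf] with t h1 h2
  rw [h1]
  change (A n).indicator f t = _
  by_cases ht : t ∈ A n <;> simp [ht, h2]

end orliczSpace

/-! ### Order continuity of functionals, from ∇₂ -/

namespace orliczSpace

open scoped InnerProductSpace

variable {N : ℕ} {G : EuclideanSpace ℝ (Fin N) → ℝ} {hG : IsGFunction G} {I : Set ℝ}
  {hI : Bornology.IsBounded I}

/-- If the restrictions of a functional to the sets `A n` do not become small, then it is large
on sums of arbitrarily many elements with disjoint supports and modular at most one. -/
theorem exists_block_sum (ℓ : StrongDual ℝ (orliczSpace hG hI)) {A : ℕ → Set ℝ}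
    (hA : ∀ n, MeasurableSet (A n)) (hanti : Antitone A) (hlim : ∀ t, ∀ᶠ n in atTop, t ∉ A n)
    {δ : ℝ} (hδ : ∀ n, δ < ‖ℓ.comp (restrictTo (A n) (hA n))‖) (m n : ℕ) :
    ∃ p, n ≤ p ∧ ∃ w : orliczSpace hG hI,
      (∀ᵐ t ∂(volume.restrict I), t ∉ A n \ A p → w.1 t = 0) ∧ m * δ ≤ ℓ w ∧
        orliczModular G I w.1 ≤ m := by
  -- One block: take `u` in the open unit ball on which the restricted functional exceeds `δ`, then
  -- discard its part on `A p`, with `p` so large that the value stays above `δ`.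
  have step : ∀ n, ∃ p, n ≤ p ∧ ∃ w : orliczSpace hG hI,
      (∀ᵐ t ∂(volume.restrict I), t ∉ A n \ A p → w.1 t = 0) ∧ δ ≤ ℓ w ∧
        orliczModular G I w.1 ≤ 1 := by
    intro n
    obtain ⟨u, hu1, hu⟩ : ∃ u : orliczSpace hG hI, ‖u‖ < 1 ∧ δ < ℓ (restrictTo (A n) (hA n) u) := by
      obtain ⟨u, hu1, hu⟩ := ContinuousLinearMap.exists_lt_apply_of_lt_opNorm _ (hδ n)
      rw [Real.norm_eq_abs, lt_abs] at hu
      rcases hu with hu | hu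
      · exact ⟨u, hu1, hu⟩
      · exact ⟨-u, by rwa [norm_neg], by rw [map_neg, map_neg]; exact hu⟩
    have h := (tendsto_const_nhds (x := ℓ (restrictTo (A n) (hA n) u))).sub
      ((ℓ.continuous.tendsto 0).comp (tendsto_restrictTo_zero hA hlim (restrictTo (A n) (hA n) u)))
    rw [map_zero, sub_zero] at h
    obtain ⟨p, hp, hnp⟩ := ((h.eventually_const_lt hu).and (eventually_ge_atTop n)).exists
    set v := restrictTo (A n) (hA n) u
    have hv : v - restrictTo (A p) (hA p) v = restrictTo (A p)ᶜ (hA p).compl v := by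
      rw [sub_eq_iff_eq_add']
      exact (restrictTo_add_compl _ _ v).symm
    simp only [Function.comp_apply, ← map_sub, hv] at hp
    have hc : (restrictTo (A p)ᶜ (hA p).compl v).1 =ᵐ[volume.restrict I]
        (A n \ A p).indicator u.1 := by
      have e : (A p)ᶜ ∩ A n = A n \ A p := by rw [Set.sdiff_eq, Set.inter_comm]
      rw [← e]
      rw [restrictTo_restrictTo]
      exact coeFn_restrictTo _ _ u
    refine ⟨p, hnp, restrictTo (A p)ᶜ (hA p).compl v, ?_, hp.le, ?_⟩
    · filter_upwards [hc] with t ht h0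
      rw [ht, Set.indicator_of_notMem h0]
    · rw [orliczModular_congr G hc]
      refine le_trans ?_ (modular_le_one_of_norm_lt_one u hu1)
      simpa using modular_indicator_le (I := I) (A n \ A p) u.1 1 hG
  induction m generalizing n with
  | zero => exact ⟨n, le_rfl, 0, by
      filter_upwards [AEEqFun.coeFn_zero (α := ℝ) (μ := volume.restrict I)
        (β := EuclideanSpace ℝ (Fin N))] with t ht _ using ht, by simp, by
      refine (orliczModular_congr G AEEqFun.coeFn_zero).trans_le ?_
      simp [orliczModular, hG.map_zero]⟩
  | succ m ih =>
    obtain ⟨p, hnp, w, hw, hwℓ, hwm⟩ := step n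
    obtain ⟨q, hpq, w', hw', hwℓ', hwm'⟩ := ih p
    refine ⟨q, hnp.trans hpq, w + w', ?_, ?_, ?_⟩
    · filter_upwards [AEEqFun.coeFn_add w.1 w'.1, hw, hw'] with t h1 h2 h3 ht
      refine h1.trans ?_
      rw [Pi.add_apply, h2 fun h => ht ⟨h.1, fun hq => h.2 (hanti hpq hq)⟩,
        h3 fun h => ht ⟨hanti hnp h.1, h.2⟩, add_zero]
    · rw [map_add, Nat.cast_succ]
      linarith
    · calc orliczModular G I (w.1 + w'.1 : ℝ →ₘ[volume.restrict I] EuclideanSpace ℝ (Fin N))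
          -- `A p` separates the supports: `w` vanishes on it and `w'` off it. So the modular of the
          -- sum is at most the sum of the modulars.
          ≤ ∫⁻ t in I, (ENNReal.ofReal (G (w.1 t)) + ENNReal.ofReal (G (w'.1 t))) := by
            refine lintegral_mono_ae ?_
            filter_upwards [AEEqFun.coeFn_add w.1 w'.1, hw, hw'] with t h1 h2 h3
            rw [h1, Pi.add_apply]
            by_cases ht : t ∈ A p
            · rw [h2 fun h => h.2 ht, zero_add]
              exact le_add_self
            · rw [h3 fun h => ht h.1, add_zero]
              exact le_self_add
        _ = orliczModular G I w.1 + orliczModular G I w'.1 :=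
            lintegral_add_left' (hG.measurable_modular_integrand w.1.aemeasurable) _
        _ ≤ 1 + m := add_le_add hwm hwm'
        _ = (m + 1 : ℕ) := by push_cast; rw [add_comm]

/-- Otherwise sums of disjoint blocks, rescaled through ∇₂, would give `2 ^ j * δ ≤ ‖ℓ‖ * (2 + C *
V)` for every `j`. -/
theorem exists_norm_comp_restrictTo_le (ℓ : StrongDual ℝ (orliczSpace hG hI)) {A : ℕ → Set ℝ}
    (hA : ∀ n, MeasurableSet (A n)) (hanti : Antitone A) (hlim : ∀ t, ∀ᶠ n in atTop, t ∉ A n)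
    {δ : ℝ} (hδ : 0 < δ) : ∃ n, ‖ℓ.comp (restrictTo (A n) (hA n))‖ ≤ δ := by
  by_contra! hlt
  obtain ⟨K, hK, C, hC, hKC⟩ := hG.exists_inv_pow_smul_le
  set V := (volume I).toReal
  have hV : 0 ≤ V := ENNReal.toReal_nonneg
  have key : ∀ j : ℕ, 2 ^ j * δ ≤ ‖ℓ‖ * (2 + C * V) := by
    intro j
    have hKj : 0 < K ^ j := by positivity
    have h2K : 1 ≤ (2 * K) ^ j := one_le_pow₀ (by linarith)
    -- This many blocks are balanced by the ∇₂ factor `((2 * K) ^ j)⁻¹`: after contraction by `K ^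
    -- j` they contribute at most 2 to the modular, rounding included.
    set m := ⌈(2 * K) ^ j⌉₊
    have hm : (m : ℝ) ≤ 2 * (2 * K) ^ j := by
      have := Nat.ceil_lt_add_one (show 0 ≤ (2 * K) ^ j by positivity)
      linarith
    have hm' : (2 * K) ^ j ≤ m := Nat.le_ceil _
    obtain ⟨-, -, w, -, hwℓ, hwm⟩ := exists_block_sum ℓ hA hanti hlim hlt m 0
    have hmod : orliczModular G I (fun t => (K ^ j)⁻¹ • w.1 t) ≤ ENNReal.ofReal (2 + C * V) := by
      calc orliczModular G I (fun t => (K ^ j)⁻¹ • w.1 t)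
          ≤ ∫⁻ t in I, (ENNReal.ofReal ((2 * K) ^ j)⁻¹ * ENNReal.ofReal (G (w.1 t)) +
              ENNReal.ofReal C) := by
            refine lintegral_mono fun t => ?_
            rw [← ENNReal.ofReal_mul (by positivity),
              ← ENNReal.ofReal_add (mul_nonneg (by positivity) (hG.nonneg _)) hC]
            exact ENNReal.ofReal_le_ofReal (hKC j _)
        _ = ENNReal.ofReal ((2 * K) ^ j)⁻¹ * orliczModular G I w.1 +
              ENNReal.ofReal C * volume I := by
            rw [lintegral_add_right _ measurable_const,
              lintegral_const_mul' _ _ ENNReal.ofReal_ne_top]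
            simp [orliczModular]
        _ ≤ ENNReal.ofReal ((2 * K) ^ j)⁻¹ * ENNReal.ofReal m +
              ENNReal.ofReal C * ENNReal.ofReal V := by
            rw [ENNReal.ofReal_toReal hI.measure_lt_top.ne, ENNReal.ofReal_natCast]
            gcongr
        _ = ENNReal.ofReal (((2 * K) ^ j)⁻¹ * m + C * V) := by
            rw [ENNReal.ofReal_add (by positivity) (by positivity),
              ENNReal.ofReal_mul (by positivity), ENNReal.ofReal_mul hC]
        _ ≤ ENNReal.ofReal (2 + C * V) := by
            refine ENNReal.ofReal_le_ofReal ?_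
            have : ((2 * K) ^ j)⁻¹ * m ≤ 2 := by
              rw [inv_mul_le_iff₀ (by positivity)]
              linarith
            linarith
    have hnorm := norm_le_of_modular_le w hKj
      (by have := mul_nonneg hC hV; linarith : (1 : ℝ) ≤ 2 + C * V) hmod
    have h1 : K ^ j * (2 ^ j * δ) ≤ K ^ j * (‖ℓ‖ * (2 + C * V)) :=
      calc K ^ j * (2 ^ j * δ) = (2 * K) ^ j * δ := by rw [mul_pow]; ring
        _ ≤ m * δ := by gcongr
        _ ≤ ℓ w := hwℓ
        _ ≤ ‖ℓ‖ * ‖w‖ := (le_abs_self _).trans (ℓ.le_opNorm w)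
        _ ≤ ‖ℓ‖ * (K ^ j * (2 + C * V)) := by gcongr
        _ = K ^ j * (‖ℓ‖ * (2 + C * V)) := by ring
    exact le_of_mul_le_mul_left h1 hKj
  obtain ⟨j, hj⟩ := pow_unbounded_of_one_lt (‖ℓ‖ * (2 + C * V) / δ) (one_lt_two : (1 : ℝ) < 2)
  rw [div_lt_iff₀ hδ] at hj
  exact absurd (key j) (not_le.2 hj)

/-- Functionals on the Orlicz space are order continuous. -/
theorem tendsto_norm_comp_restrictTo (ℓ : StrongDual ℝ (orliczSpace hG hI)) {A : ℕ → Set ℝ}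
    (hA : ∀ n, MeasurableSet (A n)) (hanti : Antitone A) (hlim : ∀ t, ∀ᶠ n in atTop, t ∉ A n) :
    Tendsto (fun n => ‖ℓ.comp (restrictTo (A n) (hA n))‖) atTop (𝓝 0) := by
  rw [Metric.tendsto_atTop']
  intro ε hε
  obtain ⟨n, hn⟩ := exists_norm_comp_restrictTo_le ℓ hA hanti hlim (half_pos hε)
  refine ⟨n, fun m hm => ?_⟩
  rw [Real.dist_0_eq_abs, abs_of_nonneg (norm_nonneg _)]
  -- As `A m ⊆ A n` and restrictions are contractions, smallness at one index persists at all later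
  -- ones.
  have e : ℓ.comp (restrictTo (A m) (hA m)) =
      (ℓ.comp (restrictTo (A n) (hA n))).comp (restrictTo (A m) (hA m)) := by
    ext u
    have h := restrictTo_restrictTo (A n) (A m) (hA n) (hA m) u
    simp only [Set.inter_eq_right.2 (hanti hm.le)] at h
    simp [h]
  calc ‖ℓ.comp (restrictTo (A m) (hA m))‖
      ≤ ‖ℓ.comp (restrictTo (A n) (hA n))‖ *
          ‖(restrictTo (A m) (hA m) : orliczSpace hG hI →L[ℝ] orliczSpace hG hI)‖ := by
        rw [e]
        exact ContinuousLinearMap.opNorm_comp_le _ _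
    _ ≤ ε / 2 * 1 := mul_le_mul hn (norm_restrictTo_le _ _) (norm_nonneg _) (half_pos hε).le
    _ < ε := by linarith

/-! ### The pairing with bounded functions -/

theorem integrable_modular (u : orliczSpace hG hI) :
    Integrable (fun t => G (u.1 t)) (volume.restrict I) :=
  (lintegral_ofReal_ne_top_iff_integrable
    (hG.continuous.measurable.comp_aemeasurable u.1.aemeasurable).aestronglyMeasurable
    (ae_of_all _ fun _ => hG.nonneg _)).1 u.2.ne

theorem integral_modular_le_one (u : orliczSpace hG hI) (hu : ‖u‖ < 1) :
    ∫ t in I, G (u.1 t) ≤ 1 := by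
  rw [integral_eq_lintegral_of_nonneg_ae (ae_of_all _ fun _ => hG.nonneg _)
    (integrable_modular u).1]
  exact ENNReal.toReal_le_of_le_ofReal zero_le_one
    ((modular_le_one_of_norm_lt_one u hu).trans ENNReal.ofReal_one.ge)

theorem isFiniteMeasure_restrict_of_isBounded (hI : Bornology.IsBounded I) :
    IsFiniteMeasure (volume.restrict I) :=
  MeasureTheory.isFiniteMeasure_restrict.2 hI.measure_lt_top.ne

theorem integrable_coe (u : orliczSpace hG hI) : Integrable u.1 (volume.restrict I) := by
  have := isFiniteMeasure_restrict_of_isBounded hI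
  obtain ⟨R, -, hR⟩ := hG.exists_norm_le zero_lt_one
  refine ((integrable_const R).add ((integrable_modular u).const_mul 1)).mono'
    u.1.aestronglyMeasurable (ae_of_all _ fun t => hR _)

theorem integrable_bounded (hI : Bornology.IsBounded I)
    (v : boundedMeasurable ℝ (EuclideanSpace ℝ (Fin N))) :
    Integrable v.1 (volume.restrict I) := by
  have := isFiniteMeasure_restrict_of_isBounded hI
  obtain ⟨hm, C, hC⟩ := v.2
  exact (integrable_const C).mono' hm.aestronglyMeasurable (ae_of_all _ hC)

theorem integrable_inner_bounded (v : boundedMeasurable ℝ (EuclideanSpace ℝ (Fin N)))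
    (u : orliczSpace hG hI) : Integrable (fun t => ⟪v.1 t, u.1 t⟫_ℝ) (volume.restrict I) :=
  (boundedMeasurable.integrable_inner (integrable_coe u) v).congr
    (ae_of_all _ fun _ => real_inner_comm _ _)

/-- Splitting `‖u‖` as `R + ε * G u` separates the L¹ size of `v` from its sup bound, the latter
weighted only by ε since `u` has modular at most 1. -/
theorem abs_integral_inner_le (v : boundedMeasurable ℝ (EuclideanSpace ℝ (Fin N))) {C R ε : ℝ}
    (hC : ∀ t, ‖v.1 t‖ ≤ C) (hε : 0 ≤ ε) (hR : ∀ x, ‖x‖ ≤ R + ε * G x) (u : orliczSpace hG hI)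
    (hu : ‖u‖ < 1) :
    |∫ t in I, ⟪v.1 t, u.1 t⟫_ℝ| ≤ R * (∫ t in I, ‖v.1 t‖) + ε * C := by
  have hC0 : 0 ≤ C := (norm_nonneg _).trans (hC 0)
  have hi1 := (integrable_bounded hI v).norm.const_mul R
  have hi2 := (integrable_modular u).const_mul (ε * C)
  calc |∫ t in I, ⟪v.1 t, u.1 t⟫_ℝ| ≤ ∫ t in I, (R * ‖v.1 t‖ + ε * C * G (u.1 t)) := by
        rw [← Real.norm_eq_abs]
        refine norm_integral_le_of_norm_le (hi1.add hi2) (ae_of_all _ fun t => ?_)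
        calc ‖⟪v.1 t, u.1 t⟫_ℝ‖ ≤ ‖v.1 t‖ * ‖u.1 t‖ := norm_inner_le_norm _ _
          _ ≤ ‖v.1 t‖ * (R + ε * G (u.1 t)) := by gcongr; exact hR _
          _ = R * ‖v.1 t‖ + ε * ‖v.1 t‖ * G (u.1 t) := by ring
          _ ≤ R * ‖v.1 t‖ + ε * C * G (u.1 t) := by
            gcongr
            · exact hG.nonneg _
            · exact hC t
    _ = R * (∫ t in I, ‖v.1 t‖) + ε * C * ∫ t in I, G (u.1 t) := by
        rw [integral_add hi1 hi2, integral_const_mul, integral_const_mul]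
    _ ≤ R * (∫ t in I, ‖v.1 t‖) + ε * C * 1 := by
        gcongr
        exact integral_modular_le_one u hu
    _ = _ := by rw [mul_one]

/-- The linear form `u ↦ ∫_I ⟨v, u⟩ dt`. -/
noncomputable def pairingLin (v : boundedMeasurable ℝ (EuclideanSpace ℝ (Fin N))) :
    orliczSpace hG hI →ₗ[ℝ] ℝ where
  toFun u := ∫ t in I, ⟪v.1 t, u.1 t⟫_ℝ
  map_add' u u' := by
    rw [← integral_add (integrable_inner_bounded v u) (integrable_inner_bounded v u')]
    refine integral_congr_ae ?_
    filter_upwards [AEEqFun.coeFn_add u.1 u'.1] with t ht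
    rw [← inner_add_right]
    exact congrArg _ ht
  map_smul' c u := by
    rw [RingHom.id_apply, smul_eq_mul, ← integral_const_mul]
    refine integral_congr_ae ?_
    filter_upwards [AEEqFun.coeFn_smul c u.1] with t ht
    rw [← real_inner_smul_right]
    exact congrArg _ ht

theorem exists_norm_pairingLin_le (v : boundedMeasurable ℝ (EuclideanSpace ℝ (Fin N))) :
    ∃ B, ∀ u : orliczSpace hG hI, ‖pairingLin v u‖ ≤ B * ‖u‖ := by
  obtain ⟨-, C, hC⟩ := v.2
  obtain ⟨R, -, hR⟩ := hG.exists_norm_le zero_lt_one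
  exact ⟨_, LinearMap.norm_le_mul_norm_of_unit_ball _
    (abs_integral_inner_le v hC zero_le_one hR)⟩

variable (hG hI) in
/-- The pairing `(v, u) ↦ ∫_I ⟨v, u⟩ dt` of bounded functions with the Orlicz space. -/
noncomputable def pairing :
    boundedMeasurable ℝ (EuclideanSpace ℝ (Fin N)) →ₗ[ℝ] StrongDual ℝ (orliczSpace hG hI) where
  toFun v := (pairingLin v).mkContinuousOfExistsBound (exists_norm_pairingLin_le v)
  map_add' v v' := by
    ext u
    change ∫ t in I, ⟪v.1 t + v'.1 t, u.1 t⟫_ℝ =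
      (∫ t in I, ⟪v.1 t, u.1 t⟫_ℝ) + ∫ t in I, ⟪v'.1 t, u.1 t⟫_ℝ
    rw [← integral_add (integrable_inner_bounded v u) (integrable_inner_bounded v' u)]
    simp_rw [inner_add_left]
  map_smul' c v := by
    ext u
    change ∫ t in I, ⟪c • v.1 t, u.1 t⟫_ℝ = c * ∫ t in I, ⟪v.1 t, u.1 t⟫_ℝ
    rw [← integral_const_mul]
    simp_rw [real_inner_smul_left]

theorem norm_pairing_le (v : boundedMeasurable ℝ (EuclideanSpace ℝ (Fin N))) {C R ε : ℝ}
    (hC : ∀ t, ‖v.1 t‖ ≤ C) (hε : 0 ≤ ε) (hR0 : 0 ≤ R) (hR : ∀ x, ‖x‖ ≤ R + ε * G x) :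
    ‖pairing hG hI v‖ ≤ R * (∫ t in I, ‖v.1 t‖) + ε * C := by
  refine ContinuousLinearMap.opNorm_le_bound _ ?_ (LinearMap.norm_le_mul_norm_of_unit_ball _
    (abs_integral_inner_le v hC hε hR))
  have := (norm_nonneg _).trans (hC 0)
  positivity

theorem tendsto_pairing {f : ℕ → boundedMeasurable ℝ (EuclideanSpace ℝ (Fin N))}
    {g : boundedMeasurable ℝ (EuclideanSpace ℝ (Fin N))} {C : ℝ}
    (hC : ∀ n t, ‖(f n : ℝ → EuclideanSpace ℝ (Fin N)) t‖ ≤ C)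
    (hfg : ∀ᵐ t ∂(volume.restrict I), Tendsto
      (fun n => (f n : ℝ → EuclideanSpace ℝ (Fin N)) t) atTop (𝓝 (g.1 t))) :
    Tendsto (fun n => pairing hG hI (f n)) atTop (𝓝 (pairing hG hI g)) := by
  have := isFiniteMeasure_restrict_of_isBounded hI
  obtain ⟨-, D, hD⟩ := g.2
  have hCD : ∀ n t, ‖(f n - g).1 t‖ ≤ C + D := fun n t =>
    (norm_sub_le _ _).trans (add_le_add (hC n t) (hD t))
  have hCD0 : 0 ≤ C + D := (norm_nonneg _).trans (hCD 0 0)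
  have hint : Tendsto (fun n => ∫ t in I, ‖(f n - g).1 t‖) atTop (𝓝 0) := by
    have h := tendsto_integral_of_dominated_convergence (μ := volume.restrict I)
      (F := fun n t => ‖(f n - g).1 t‖) (f := fun _ => 0) (fun _ => C + D)
      (fun n => (f n - g).2.1.norm.aestronglyMeasurable) (integrable_const _)
      (fun n => ae_of_all _ fun t => by rw [norm_norm]; exact hCD n t) (by
        filter_upwards [hfg] with t ht
        have := (tendsto_sub_nhds_zero_iff.2 ht).norm
        rwa [norm_zero] at this)
    simpa using h
  rw [tendsto_iff_norm_sub_tendsto_zero, Metric.tendsto_atTop']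
  intro ε hε
  -- ε is split in two: this choice keeps the sup-bound term below `ε / 2`, and only then, with `R`
  -- fixed, is the L¹ term made small. The `+ 1` guards against `C + D = 0`.
  obtain ⟨R, hR0, hR⟩ := hG.exists_norm_le (show 0 < ε / (2 * (C + D + 1)) by positivity)
  have h1 := hint.const_mul R
  rw [mul_zero] at h1
  obtain ⟨n, hn⟩ := eventually_atTop.1 (h1.eventually_lt_const (half_pos hε))
  refine ⟨n, fun m hm => ?_⟩
  rw [Real.dist_0_eq_abs, abs_of_nonneg (norm_nonneg _), ← map_sub]
  have h2 := norm_pairing_le (hG := hG) (hI := hI) (f m - g) (hCD m) (by positivity) hR0 hR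
  have h3 : ε / (2 * (C + D + 1)) * (C + D) ≤ ε / 2 := by
    rw [div_mul_eq_mul_div, div_le_div_iff₀ (by positivity) two_pos]
    nlinarith
  linarith [hn m hm.le]

/-! ### Density of the pairing and reflexivity -/

theorem isDominatedContinuous_comp_ofBounded (ℓ : StrongDual ℝ (orliczSpace hG hI)) :
    boundedMeasurable.IsDominatedContinuous (volume.restrict I)
      (ℓ.toLinearMap ∘ₗ ofBounded hG hI) := fun _ _ _ hC hfg =>
  (ℓ.continuous.tendsto _).comp (tendsto_ofBounded hC hfg)

theorem isDominatedContinuous_comp_pairing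
    (ξ : StrongDual ℝ (StrongDual ℝ (orliczSpace hG hI))) :
    boundedMeasurable.IsDominatedContinuous (volume.restrict I)
      (ξ.toLinearMap ∘ₗ pairing hG hI) := fun _ _ _ hC hfg =>
  (ξ.continuous.tendsto _).comp (tendsto_pairing hC hfg)

theorem restrictTo_ofBounded (A : Set ℝ) (hA : MeasurableSet A)
    (f : boundedMeasurable ℝ (EuclideanSpace ℝ (Fin N))) :
    restrictTo A hA (ofBounded hG hI f) =
      ofBounded hG hI ⟨A.indicator f.1, boundedMeasurable.indicator_mem f.2 hA⟩ := by
  refine eq_of_coeFn ?_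
  filter_upwards [coeFn_restrictTo A hA (ofBounded hG hI f), coeFn_ofBounded (hG := hG) (hI := hI) f,
    coeFn_ofBounded (hG := hG) (hI := hI)
      ⟨A.indicator f.1, boundedMeasurable.indicator_mem f.2 hA⟩] with t h1 h2 h3
  rw [h1, h3]
  by_cases ht : t ∈ A <;> simp [ht, h2]

theorem pairing_ofBounded (v f : boundedMeasurable ℝ (EuclideanSpace ℝ (Fin N))) :
    pairing hG hI v (ofBounded hG hI f) = ∫ t in I, ⟪v.1 t, f.1 t⟫_ℝ := by
  refine integral_congr_ae ?_
  filter_upwards [coeFn_ofBounded (hG := hG) (hI := hI) f] with t ht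
  rw [ht]

theorem inner_indicator_left_right (A : Set ℝ) (v w : ℝ → EuclideanSpace ℝ (Fin N)) (t : ℝ) :
    ⟪A.indicator v t, w t⟫_ℝ = ⟪v t, A.indicator w t⟫_ℝ := by
  by_cases ht : t ∈ A <;> simp [ht]

theorem pairing_comp_restrictTo (A : Set ℝ) (hA : MeasurableSet A)
    (v : boundedMeasurable ℝ (EuclideanSpace ℝ (Fin N))) :
    (pairing hG hI v).comp (restrictTo A hA) =
      pairing hG hI ⟨A.indicator v.1, boundedMeasurable.indicator_mem v.2 hA⟩ := by
  ext u
  refine integral_congr_ae ?_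
  filter_upwards [coeFn_restrictTo A hA u] with t ht
  rw [inner_indicator_left_right]
  exact congrArg _ ht

/-- Functionals represented by bounded functions are dense in the dual of the Orlicz space. -/
theorem denseRange_pairing : DenseRange (pairing hG hI) := by
  have := isFiniteMeasure_restrict_of_isBounded hI
  intro ℓ
  obtain ⟨w, hw, -, hwℓ⟩ := (isDominatedContinuous_comp_ofBounded ℓ).exists_density
  let A : ℕ → Set ℝ := fun n => {t | ‖w t‖ ≤ n}
  have hA : ∀ n, MeasurableSet (A n) := fun n => hw.norm measurableSet_Iic
  have hanti : Antitone fun n => (A n)ᶜ := fun m n hmn =>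
    Set.compl_subset_compl.2 fun t (ht : ‖w t‖ ≤ m) => show ‖w t‖ ≤ n from ht.trans (Nat.cast_le.2 hmn)
  have hlim : ∀ t, ∀ᶠ n in atTop, t ∉ (A n)ᶜ := by
    intro t
    obtain ⟨n, hn⟩ := exists_nat_ge ‖w t‖
    filter_upwards [eventually_ge_atTop n] with m hm
    exact fun h => h (hn.trans (Nat.cast_le.2 hm))
  -- Both functionals are continuous, and on the dense subspace of bounded functions both integrate
  -- against `w` cut off to `A n`.
  have key : ∀ n, ℓ.comp (restrictTo (A n) (hA n)) =
      pairing hG hI ⟨_, boundedMeasurable.truncation_mem hw n⟩ := by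
    intro n
    refine ContinuousLinearMap.coeFn_injective (denseRange_ofBounded.equalizer
      (ContinuousLinearMap.continuous _) (ContinuousLinearMap.continuous _) ?_)
    funext f
    simp only [Function.comp_apply, ContinuousLinearMap.comp_apply]
    rw [restrictTo_ofBounded, pairing_ofBounded]
    refine (hwℓ _).trans ?_
    simp_rw [inner_indicator_left_right]
    rfl
  refine mem_closure_of_tendsto (f := fun n => pairing hG hI
    ⟨_, boundedMeasurable.truncation_mem hw n⟩) (b := atTop) ?_
    (Eventually.of_forall fun n => Set.mem_range_self _)
  rw [tendsto_iff_norm_sub_tendsto_zero]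
  -- The error of the approximation is exactly `ℓ` restricted to the complement of `A n`, which
  -- order continuity sends to 0.
  refine (tendsto_norm_comp_restrictTo ℓ (fun n => (hA n).compl) hanti hlim).congr fun n => ?_
  rw [← key, norm_sub_rev]
  congr 1
  ext u
  have h := congrArg ℓ (restrictTo_add_compl (A n) (hA n) u)
  rw [map_add] at h
  change ℓ (restrictTo (A n)ᶜ _ u) = ℓ u - ℓ (restrictTo (A n) _ u)
  linarith

/-- The truncated density of an element `ξ` of the bidual has norm at most `‖ξ‖`. -/
theorem norm_truncation_le (ξ : StrongDual ℝ (StrongDual ℝ (orliczSpace hG hI)))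
    {w : ℝ → EuclideanSpace ℝ (Fin N)} (hw : Measurable w)
    (hξ : ∀ v : boundedMeasurable ℝ (EuclideanSpace ℝ (Fin N)),
      ξ (pairing hG hI v) = ∫ t in I, ⟪w t, v.1 t⟫_ℝ) (n : ℕ) :
    ‖ofBounded hG hI ⟨_, boundedMeasurable.truncation_mem hw n⟩‖ ≤ ‖ξ‖ := by
  -- By Hahn–Banach it is enough to test against functionals, and by density against pairings; there
  -- the truncation can be moved from `w` onto `v`, where `ξ` controls it.
  refine NormedSpace.norm_le_dual_bound ℝ _ (norm_nonneg ξ) fun ℓ => ?_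
  refine denseRange_pairing.induction_on (p := fun ℓ : StrongDual ℝ (orliczSpace hG hI) =>
    ‖ℓ (ofBounded hG hI ⟨_, boundedMeasurable.truncation_mem hw n⟩)‖ ≤ ‖ξ‖ * ‖ℓ‖) ℓ ?_ fun v => ?_
  · refine isClosed_le ?_ (by fun_prop)
    exact (ContinuousLinearMap.apply ℝ ℝ
      (ofBounded hG hI ⟨_, boundedMeasurable.truncation_mem hw n⟩)).continuous.norm
  · have hA : MeasurableSet {t | ‖w t‖ ≤ n} := hw.norm measurableSet_Iic
    have e : pairing hG hI v (ofBounded hG hI ⟨_, boundedMeasurable.truncation_mem hw n⟩) =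
        ξ ((pairing hG hI v).comp (restrictTo _ hA)) := by
      rw [pairing_comp_restrictTo, hξ, pairing_ofBounded]
      refine integral_congr_ae (ae_of_all _ fun t => ?_)
      change ⟪v.1 t, Set.indicator _ w t⟫_ℝ = ⟪w t, Set.indicator _ v.1 t⟫_ℝ
      rw [← inner_indicator_left_right, real_inner_comm]
    rw [e]
    refine (ξ.le_opNorm _).trans (mul_le_mul_of_nonneg_left ?_ (norm_nonneg _))
    refine (ContinuousLinearMap.opNorm_comp_le _ _).trans ?_
    exact mul_le_of_le_one_right (norm_nonneg _) (norm_restrictTo_le _ hA)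

/-- Fatou carries the uniform modular bound on the scaled truncations over to `(B + 1)⁻¹ • w`, and
Δ₂ removes the scaling. -/
theorem modular_lt_top_of_norm_truncation_le {w : ℝ → EuclideanSpace ℝ (Fin N)}
    (hw : Measurable w) {B : ℝ}
    (hB : ∀ n, ‖ofBounded hG hI ⟨_, boundedMeasurable.truncation_mem hw n⟩‖ ≤ B) :
    orliczModular G I w < ∞ := by
  -- A scale strictly above all the norms gives modular at most 1 without asking whether the infimum
  -- in the norm is attained.
  have hB0 : 0 < B + 1 := by linarith [(norm_nonneg _).trans (hB 0)]
  let F : ℕ → ℝ → ℝ≥0∞ := fun n t =>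
    ENNReal.ofReal (G ((B + 1)⁻¹ • {t | ‖w t‖ ≤ n}.indicator w t))
  have hF : ∀ n, ∫⁻ t in I, F n t ≤ 1 := by
    intro n
    refine le_trans (le_of_eq ?_) (modular_le_one_of_norm_lt _ ((hB n).trans_lt (lt_add_one B)))
    exact (orliczModular_congr G ((coeFn_ofBounded (hG := hG) (hI := hI)
      ⟨_, boundedMeasurable.truncation_mem hw n⟩).fun_comp ((B + 1)⁻¹ • ·))).symm
  have hFm : ∀ n, Measurable (F n) := fun n =>
    (hG.continuous.measurable.comp
      ((boundedMeasurable.truncation_mem hw n).1.const_smul (B + 1)⁻¹)).ennreal_ofReal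
  have hmod : orliczModular G I (fun t => (B + 1)⁻¹ • w t) ≤ 1 := by
    calc orliczModular G I (fun t => (B + 1)⁻¹ • w t)
        = ∫⁻ t in I, liminf (fun n => F n t) atTop := by
          refine lintegral_congr fun t => (Tendsto.liminf_eq ?_).symm
          obtain ⟨n, hn⟩ := exists_nat_ge ‖w t‖
          refine tendsto_const_nhds.congr' ?_
          filter_upwards [eventually_ge_atTop n] with m hm
          have : t ∈ {t | ‖w t‖ ≤ m} := hn.trans (Nat.cast_le.2 hm)
          simp only [F, Set.indicator_of_mem this]
      _ ≤ liminf (fun n => ∫⁻ t in I, F n t) atTop := lintegral_liminf_le hFm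
      _ ≤ liminf (fun _ : ℕ => (1 : ℝ≥0∞)) atTop := liminf_le_liminf (Eventually.of_forall hF)
      _ = 1 := by simp
  have h := hG.modular_smul_lt_top hI (B + 1) (hmod.trans_lt ENNReal.one_lt_top)
  simpa [smul_smul, hB0.ne'] using h

variable (hG hI) in
-- The preimage of `ξ` is the class of its density `w`: evaluation at it and `ξ` coincide on
-- pairings, which are dense in the dual.
theorem isReflexiveSpace : IsReflexiveSpace (orliczSpace hG hI) := by
  have := isFiniteMeasure_restrict_of_isBounded hI
  intro ξ
  obtain ⟨w, hw, -, hξ⟩ := (isDominatedContinuous_comp_pairing ξ).exists_density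
  have hmod := modular_lt_top_of_norm_truncation_le hw (norm_truncation_le ξ hw hξ)
  let u : orliczSpace hG hI := ⟨AEEqFun.mk w hw.aestronglyMeasurable, by
    change orliczModular G I _ < ∞
    rwa [orliczModular_congr G (AEEqFun.coeFn_mk _ _)]⟩
  have hu : u.1 =ᵐ[volume.restrict I] w := AEEqFun.coeFn_mk _ _
  refine ⟨u, ContinuousLinearMap.coeFn_injective (denseRange_pairing.equalizer
    (ContinuousLinearMap.continuous _) (ContinuousLinearMap.continuous _) ?_)⟩
  funext v
  refine Eq.trans ?_ (hξ v).symm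
  refine integral_congr_ae ?_
  filter_upwards [hu] with t ht
  rw [ht, real_inner_comm]

end orliczSpace

/-- The canonical embedding is then an isometry onto the bidual, and a dual space is always
complete. -/
theorem IsReflexiveSpace.completeSpace {X : Type*} [NormedAddCommGroup X] [NormedSpace ℝ X]
    (h : IsReflexiveSpace X) : CompleteSpace X :=
  ((NormedSpace.inclusionInDoubleDualLi ℝ (E := X)).isometry.isUniformInducing.completeSpace_congr
    h).2 inferInstance

theorem mainTheorem5 {N : ℕ} {G : EuclideanSpace ℝ (Fin N) → ℝ} (hG : IsGFunction G)
    {I : Set ℝ} (hI : I.OrdConnected) (hI_bdd : Bornology.IsBounded I) :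
    CompleteSpace (orliczSpace hG hI_bdd) ∧ IsReflexiveSpace (orliczSpace hG hI_bdd) :=
  ⟨(orliczSpace.isReflexiveSpace hG hI_bdd).completeSpace, orliczSpace.isReflexiveSpace hG hI_bdd⟩
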